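/- **Conventions.** Let $\mathbb F$ be a field. A sequence of natural numbers is *polynomially bounded* if it is bounded by $p(n)$ for some polynomial $p$ and all $n$. An *arithmetic circuit* is a directed acyclic graph of gates with fanin $0$ (labelled by elements of $\mathbb F$ or variables) or $2$ (labelled $+$ or $\times$) and an output gate; its size is its number of gates. $\mathbf{VP}$ is the class of families $(f_n)$ of polynomials over $\mathbb F$ of polynomially bounded degree that are computed by arithmetic circuits of polynomially bounded size. $f$ is a *projection* of $g$ if $f$ arises from $g$ by substituting elements of $\mathbb F$ and variables of $f$ for the variables of $g$; $(f_n)$ is a *$p$-projection* of $(g_n)$ if for some polynomial $r$ each $f_n$ is a projection of $g_{r(n)}$. A *conjunctive query* $\Phi=(\mathcal S,\phi)$ consists of a finite structure $\mathcal S$ with nonempty domain $D$, over a signature of finitely many relation symbols and possibly constants, and a first-order formula $\phi$ built from relational atoms with $\wedge$ and $\exists$, in which no variable is quantified twice or is both quantified and free. Its size is the length of $\phi$ plus $|D|$ plus the number of tuples in the relations of $\mathcal S$. It is *quantifier-free* if all its variables are free. With $\phi(\mathcal S)$ the set of assignments of the free variables in $D$ that satisfy $\phi$, $$Q(\Phi)=\sum_{a\in\phi(\mathcal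 S)}\ \prod_{x\in \mathrm{free}(\phi)}X_{a(x)}\in\mathbb F[X_d: d\in D].$$ The *hypergraph* $\mathcal H=(V,E)$ of $\phi$ has the variables of $\phi$ as vertices and the variable sets of its atoms as edges. It is a *tree* if all its edges have exactly two elements and $(V,E)$ is a tree as a graph. $\Phi$ is *acyclic* (an ACQ) if $\mathcal H$ has a join tree: a finite tree $T$ with a labelling $\lambda$ of its nodes by edges of $\mathcal H$, onto $E$, such that for each $v\in V$ the nodes $t$ with $v\in\lambda(t)$ are connected in $T$. Let $S=\mathrm{free}(\phi)$. The *$S$-component* of an edge $e\not\subseteq S$ consists of the edges $e'\not\subseteq S$ for which there is a path from $e\setminus S$ to $e'\setminus S$ in the hypergraph with vertex set $V\setminus S$ and edges the nonempty sets $g\setminus S$, $g\in E$. The *quantified star size* of $\Phi$ is the largest $k$ such that, for some $S$-component, the union of its edges contains $k$ distinct elements of $S$ no two of which lie in a common edge of $\mathcal H$ (and $0$ if there is no $S$-component). **Theorem.** 1. If $(\Phi_n)$ is a family of acyclic conjunctive queries of polynomially bounded size and bounded quantified star size, then $(Q(\Phi_n))\in\mathbf{VP}$. 2. Every family $(f_n)\in\mathbf{VP}$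 is a $p$-projection of $(Q(\Phi_n))$ for some family $(\Phi_n)$ of quantifier-free conjunctive queries of polynomially bounded size whose hypergraphs are trees. Consequently these polynomials characterize $\mathbf{VP}$: a family $(f_n)$ of polynomials over $\mathbb F$ is in $\mathbf{VP}$ if and only if it is a $p$-projection of $(Q(\Phi_n))$ for some $(\Phi_n)$ as in 2, and if and only if it is a $p$-projection of $(Q(\Phi_n))$ for some $(\Phi_n)$ as in 1. -/

import Mathlib

/-- The subhypergraph of `H` induced by a vertex set `C`: vertices `C`, edges the nonempty
traces `e ∩ C`. (Only used for `C ⊆ V(H)`.) -/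
def Hypergraph.inducedOn {α : Type*} (H : Hypergraph α) (C : Set α) : Hypergraph α where
  vertexSet := C
  edgeSet := {f | f.Nonempty ∧ ∃ e ∈ H.edgeSet, f = e ∩ C}
  subset_vertexSet_of_mem_edgeSet' := by
    rintro f ⟨-, e, -, rfl⟩
    exact Set.inter_subset_right

/-- There is a path between the vertices `x` and `y`: edges `e₁, …, e_k` (`k ≥ 1`) with `x ∈ e₁`,
`y ∈ e_k` and `e_i ∩ e_{i+1} ≠ ∅`. -/
def Hypergraph.PathBetween {α : Type*} (H : Hypergraph α) (x y : α) : Prop :=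
  ∃ e ∈ H.edgeSet, ∃ f ∈ H.edgeSet, x ∈ e ∧ y ∈ f ∧ Relation.ReflTransGen H.EAdj e f

/-- A join tree of `H`: a finite tree `T` with a labelling `lam` of its nodes by edges of `H`, onto
the edges, such that for every vertex `v` the nodes whose label contains `v` are connected in `T`.
(`Preconnected`, so that a vertex in no edge imposes no condition.) -/
structure Hypergraph.IsJoinTree {α ι : Type*} (H : Hypergraph α) (T : SimpleGraph ι)
    (lam : ι → Set α) : Prop where
  isTree : T.IsTree
  label_mem : ∀ t, lam t ∈ H.edgeSet
  label_surj : ∀ e ∈ H.edgeSet, ∃ t, lam t = e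
  connected : ∀ v ∈ H.vertexSet, (T.induce {t | v ∈ lam t}).Preconnected

/-- A hypergraph is acyclic if it has a (finite) join tree. -/
def Hypergraph.IsAcyclic {α : Type*} (H : Hypergraph α) : Prop :=
  ∃ (m : ℕ) (T : SimpleGraph (Fin m)) (lam : Fin m → Set α), H.IsJoinTree T lam

/-- The edges of the `S`-component of the edge `e` (where `e ⊈ S`): the edges `e' ⊈ S` for which
there is a path from `e \ S` to `e' \ S` in the subhypergraph induced by `V(H) \ S`. -/
def Hypergraph.componentEdges {α : Type*} (H : Hypergraph α) (S e : Set α) : Set (Set α) :=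
  {e' | e' ∈ H.edgeSet ∧ ¬ e' ⊆ S ∧
    ∃ x ∈ e \ S, ∃ y ∈ e' \ S, (H.inducedOn (H.vertexSet \ S)).PathBetween x y}

/-- `H` contains an `S`-`k`-star: for some `S`-component with vertex set `V'`, there are `k`
distinct vertices in `V' ∩ S` such that no edge of `H` contains more than one of them. -/
def Hypergraph.HasStar {α : Type*} (H : Hypergraph α) (S : Set α) (k : ℕ) : Prop :=
  ∃ e ∈ H.edgeSet, ¬ e ⊆ S ∧ ∃ Y : Finset α, Y.card = k ∧
    (Y : Set α) ⊆ ⋃₀ (H.componentEdges S e) ∩ S ∧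
    ∀ f ∈ H.edgeSet, ((Y : Set α) ∩ f).Subsingleton

/-- The `S`-star size: the maximal `k` such that there is an `S`-`k`-star; it is `0` if there is no
`S`-component. (For finite vertex sets the set of such `k` is bounded.) -/
noncomputable def Hypergraph.starSize {α : Type*} (H : Hypergraph α) (S : Set α) : ℕ :=
  sSup {k | H.HasStar S k}

/-- The graph on the vertices of `H` joining distinct vertices that share an edge. -/
def Hypergraph.primalGraph {α : Type*} (H : Hypergraph α) : SimpleGraph H.vertexSet where
  Adj x y := x ≠ y ∧ H.Adj x y
  symm := ⟨fun _ _ h => ⟨h.1.symm, h.2.symm⟩⟩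
  loopless := ⟨fun _ h => h.1 rfl⟩

/-- The hypergraph is a tree: all its edges have exactly two vertices, and the graph they form is a
tree. -/
def Hypergraph.IsTreeGraph {α : Type*} (H : Hypergraph α) : Prop :=
  (∀ e ∈ H.edgeSet, e.ncard = 2) ∧ H.primalGraph.IsTree

namespace ConjQuery

/-- A signature: finitely many relation symbols with arities, and constant symbols. -/
structure Signature where
  Rel : Type
  arity : Rel → ℕ
  Con : Type
  [finRel : Fintype Rel]

/-- A finite structure with nonempty domain. -/
structure FinStructure (σ : Signature) where
  Dom : Type
  [finDom : Fintype Dom]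
  [nonemptyDom : Nonempty Dom]
  rel : ∀ r : σ.Rel, Finset (Fin (σ.arity r) → Dom)
  con : σ.Con → Dom

attribute [instance] Signature.finRel FinStructure.finDom FinStructure.nonemptyDom

/-- The size `|𝒮|`: number of domain elements plus number of tuples in relations. -/
def FinStructure.size {σ : Signature} (S : FinStructure σ) : ℕ :=
  Fintype.card S.Dom + ∑ r : σ.Rel, (S.rel r).card

/-- An argument of an atom: a variable (a natural number) or a constant symbol. -/
inductive Arg (σ : Signature) where
  | var (x : ℕ)
  | const (c : σ.Con)

def Arg.vars {σ : Signature} : Arg σ → Finset ℕ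
  | .var x => {x}
  | .const _ => ∅

def Arg.eval {σ : Signature} (S : FinStructure σ) (v : ℕ → S.Dom) : Arg σ → S.Dom
  | .var x => v x
  | .const c => S.con c

/-- First-order formulas built from relational atoms with `∧` and `∃`. -/
inductive Formula (σ : Signature) where
  | atom (r : σ.Rel) (t : Fin (σ.arity r) → Arg σ)
  | and (φ ψ : Formula σ)
  | ex (x : ℕ) (φ : Formula σ)

namespace Formula

variable {σ : Signature}

/-- The variables occurring in the formula (free, bound, or next to a quantifier). -/
def vars : Formula σ → Finset ℕ
  | atom _ t => Finset.univ.biUnion fun i => (t i).vars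
  | and φ ψ => φ.vars ∪ ψ.vars
  | ex x φ => insert x φ.vars

/-- The free variables. -/
def free : Formula σ → Finset ℕ
  | atom _ t => Finset.univ.biUnion fun i => (t i).vars
  | and φ ψ => φ.free ∪ ψ.free
  | ex x φ => φ.free.erase x

/-- The quantified variables. -/
def bound : Formula σ → Finset ℕ
  | atom _ _ => ∅
  | and φ ψ => φ.bound ∪ ψ.bound
  | ex x φ => insert x φ.bound

/-- The variable sets of the atoms. -/
def atomVars : Formula σ → Finset (Finset ℕ)
  | atom _ t => {Finset.univ.biUnion fun i => (t i).vars}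
  | and φ ψ => φ.atomVars ∪ ψ.atomVars
  | ex _ φ => φ.atomVars

/-- The usual convention on variable names: no variable is quantified twice, and no variable is
both quantified and free. -/
def Clean : Formula σ → Prop
  | atom _ _ => True
  | and φ ψ => φ.Clean ∧ ψ.Clean ∧ Disjoint φ.bound ψ.vars ∧ Disjoint φ.vars ψ.bound
  | ex x φ => φ.Clean ∧ x ∉ φ.bound

/-- The size `|φ|`: number of symbols (relation symbols, arguments, `∧`, and two for `∃ x`). -/
def size : Formula σ → ℕ
  | atom r _ => 1 + σ.arity r
  | and φ ψ => φ.size + ψ.size + 1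
  | ex _ φ => φ.size + 2

/-- Satisfaction. -/
def Sat (S : FinStructure σ) : Formula σ → (ℕ → S.Dom) → Prop
  | atom r t, v => (fun i => (t i).eval S v) ∈ S.rel r
  | and φ ψ, v => φ.Sat S v ∧ ψ.Sat S v
  | ex x φ, v => ∃ d : S.Dom, φ.Sat S (Function.update v x d)

theorem atomVars_subset_vars (φ : Formula σ) : ∀ e ∈ φ.atomVars, e ⊆ φ.vars := by
  induction φ with
  | atom r t => intro e he; simp only [atomVars, Finset.mem_singleton] at he; subst he; rfl
  | and φ ψ ih₁ ih₂ =>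
    intro e he
    rcases Finset.mem_union.1 he with h | h
    · exact (ih₁ e h).trans Finset.subset_union_left
    · exact (ih₂ e h).trans Finset.subset_union_right
  | ex x φ ih => intro e he; exact (ih e he).trans (Finset.subset_insert _ _)

/-- The hypergraph of a formula: its vertices are the variables, and its edges are the variable sets
of the atoms. -/
def hypergraph (φ : Formula σ) : Hypergraph ℕ where
  vertexSet := φ.vars
  edgeSet := {e | ∃ f ∈ φ.atomVars, e = (f : Set ℕ)}
  subset_vertexSet_of_mem_edgeSet' := by
    rintro e ⟨f, hf, rfl⟩
    exact_mod_cast φ.atomVars_subset_vars f hf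

/-- The quantified star size: the `S`-star size of the hypergraph, `S` the set of free variables. -/
noncomputable def quantifiedStarSize (φ : Formula σ) : ℕ :=
  φ.hypergraph.starSize φ.free

/-- All variables are free. -/
def IsQuantifierFree (φ : Formula σ) : Prop := φ.free = φ.vars

end Formula

end ConjQuery

/-- A conjunctive query instance `Φ = (𝒮, φ)`. -/
structure ConjQuery where
  sig : ConjQuery.Signature
  str : ConjQuery.FinStructure sig
  formula : ConjQuery.Formula sig
  clean : formula.Clean

namespace ConjQuery

/-- The size `‖Φ‖ = |φ| + |𝒮|`. -/
def size (Φ : ConjQuery) : ℕ := Φ.formula.size + Φ.str.size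

/-- Acyclic conjunctive queries. -/
def IsACQ (Φ : ConjQuery) : Prop := Φ.formula.hypergraph.IsAcyclic

/-- An assignment of the free variables is a solution if it satisfies the formula. As satisfaction
is defined for assignments of all variables, one takes an extension (all of them give the same
result, since only the values of the free variables matter). -/
def IsSolution (Φ : ConjQuery) (a : Φ.formula.free → Φ.str.Dom) : Prop :=
  ∃ v : ℕ → Φ.str.Dom, (∀ x : Φ.formula.free, v x = a x) ∧ Φ.formula.Sat Φ.str v

open scoped Classical in
/-- The polynomial `Q(Φ) = ∑_{a ∈ φ(𝒮)} ∏_x X_{a(x)}`, in the variables `X_d` for `d` in the domain,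
where `x` ranges over the variables assigned by `a`, that is, the free variables. -/
noncomputable def Q (F : Type*) [Field F] (Φ : ConjQuery) : MvPolynomial Φ.str.Dom F :=
  ∑ a : Φ.formula.free → Φ.str.Dom with Φ.IsSolution a, ∏ x, MvPolynomial.X (a x)

end ConjQuery

/-- A gate of an arithmetic circuit; `add` and `mul` refer to two of the first `k` gates. -/
inductive ArithGate (F τ : Type*) (k : ℕ) where
  | const (c : F)
  | var (x : τ)
  | add (i j : Fin k)
  | mul (i j : Fin k)

/-- An arithmetic circuit: a directed acyclic graph of gates of fanin `0` or `2`, numbered in a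
topological order, with an output gate. -/
structure ArithCircuit (F τ : Type*) where
  /-- The number of gates. -/
  size : ℕ
  gate : ∀ i : Fin size, ArithGate F τ i
  output : Fin size

/-- The polynomial computed at a gate. -/
noncomputable def ArithCircuit.value {F τ : Type*} [Field F] (C : ArithCircuit F τ)
    (i : Fin C.size) : MvPolynomial τ F :=
  match C.gate i with
  | .const c => MvPolynomial.C c
  | .var x => MvPolynomial.X x
  | .add j k => C.value ⟨j, j.2.trans i.2⟩ + C.value ⟨k, k.2.trans i.2⟩
  | .mul j k => C.value ⟨j, j.2.trans i.2⟩ * C.value ⟨k, k.2.trans i.2⟩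
termination_by i.val
decreasing_by all_goals simp

/-- The polynomial computed by the circuit. -/
noncomputable def ArithCircuit.poly {F τ : Type*} [Field F] (C : ArithCircuit F τ) :
    MvPolynomial τ F :=
  C.value C.output

/-- Polynomially bounded sequences. -/
def PolyBounded (s : ℕ → ℕ) : Prop := ∃ p : Polynomial ℕ, ∀ n, s n ≤ p.eval n

/-- The class `VP` over `F`: families of polynomially bounded degree that are computed by arithmetic
circuits of polynomially bounded size. -/
def IsVP {F : Type*} [Field F] {τ : ℕ → Type*} (f : ∀ n, MvPolynomial (τ n) F) : Prop :=
  PolyBounded (fun n => (f n).totalDegree) ∧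
    ∃ C : ∀ n, ArithCircuit F (τ n), (∀ n, (C n).poly = f n) ∧ PolyBounded (fun n => (C n).size)

/-- `f` is a projection of `g`: it arises from `g` by substituting constants and variables. -/
def IsProjection {F : Type*} [Field F] {τ υ : Type*} (f : MvPolynomial τ F)
    (g : MvPolynomial υ F) : Prop :=
  ∃ s : υ → F ⊕ τ, f = MvPolynomial.aeval (fun y => Sum.elim MvPolynomial.C MvPolynomial.X (s y)) g

/-- `(f_n)` is a `p`-projection of `(g_n)`: for some polynomial `r`, each `f_n` is a projection of
`g_{r(n)}`. -/
def IsPProjection {F : Type*} [Field F] {τ υ : ℕ → Type*} (f : ∀ n, MvPolynomial (τ n) F)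
    (g : ∀ n, MvPolynomial (υ n) F) : Prop :=
  ∃ r : Polynomial ℕ, ∀ n, IsProjection (f n) (g (r.eval n))

/-! Membership in VP. Let `S` be the set of free variables. Once `S` is fixed, quantified variables
in different `S`-components do not interact, so an assignment of `S` is a solution as soon as its
restriction to each bag extends to a model of all atoms; the bag of an edge is the edge itself if it
lies in `S`, and otherwise the part of `S` met by its component (`exists_matrixSat_of_bags`).
Relabelling a join tree by these bags gives a tree decomposition of `S`
(`preconnected_componentBag`). Bags may be large, but in an acyclic hypergraph every vertex set has
an edge cover no larger than some independent subset (`exists_independent_cover`). Star size at most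
`k` therefore leaves a bag covered by `k + 1` atoms, and only polynomially many of its assignments
survive. Now `Q` is a sum over assignments of a product of 0/1 weights, one for each bag, and
eliminating the bags from the leaves of the tree computes it (`exists_straightLine_treeSum`). Since
VP is nonuniform, the weights are simply wired in.

Universality. A sum over the consistent labellings of a tree of a product of vertex weights is a
projection of the polynomial of a tree query (`isProjection_query`). It remains to unfold a circuit
into a tree of polynomial size with polynomially many labels, by depth reduction in the manner of
Valiant, Skyum, Berkowitz and Rackoff. Take the homogeneous components of the gates and the formal
derivatives of components by one another (`comp`, `context`). Expanding along the gates where the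
degree crosses a threshold writes every such polynomial of degree up to `2 * h + 1` as a linear
combination of triple products, from which those of degree at most `h` are reached in two rounds
(`comp_mem_tripleSpan`, `context_mem_tripleSpan`).

In a tree, a linear combination costs nothing but a choice of label at the root, and a triple
product costs three subtrees; one tree serves all the polynomials of a round at once
(`IsRepresented.step`). The size triples in each of logarithmically many steps, so it stays
polynomial. The remaining implications follow since VP is closed under `p`-projections and tree
queries without quantifiers are acyclic of star size `0`. -/

/-! ### Polynomial bounds, substitution in circuits, closure of VP under `p`-projections -/

namespace PolyBounded

theorem mono {s t : ℕ → ℕ} (ht : PolyBounded t) (h : ∀ n, s n ≤ t n) : PolyBounded s := by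
  obtain ⟨p, hp⟩ := ht
  exact ⟨p, fun n => (h n).trans (hp n)⟩

theorem const (c : ℕ) : PolyBounded fun _ => c := ⟨Polynomial.C c, fun n => by simp⟩

theorem add {s t : ℕ → ℕ} (hs : PolyBounded s) (ht : PolyBounded t) :
    PolyBounded fun n => s n + t n := by
  obtain ⟨p, hp⟩ := hs
  obtain ⟨q, hq⟩ := ht
  exact ⟨p + q, fun n => by simpa using add_le_add (hp n) (hq n)⟩

theorem mul {s t : ℕ → ℕ} (hs : PolyBounded s) (ht : PolyBounded t) :
    PolyBounded fun n => s n * t n := by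
  obtain ⟨p, hp⟩ := hs
  obtain ⟨q, hq⟩ := ht
  exact ⟨p * q, fun n => by simpa using Nat.mul_le_mul (hp n) (hq n)⟩

theorem pow {s : ℕ → ℕ} (hs : PolyBounded s) (k : ℕ) : PolyBounded fun n => s n ^ k := by
  obtain ⟨p, hp⟩ := hs
  exact ⟨p ^ k, fun n => by simpa using Nat.pow_le_pow_left (hp n) k⟩

theorem comp_eval {s : ℕ → ℕ} (hs : PolyBounded s) (r : Polynomial ℕ) :
    PolyBounded fun n => s (r.eval n) := by
  obtain ⟨p, hp⟩ := hs
  exact ⟨p.comp r, fun n => by simpa using hp _⟩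

end PolyBounded

section GateValue

variable {F : Type*} [Field F] {τ : Type*}

/-- The polynomial computed by a gate from the polynomials computed by earlier gates. -/
noncomputable def ArithGate.value {k : ℕ} (v : ℕ → MvPolynomial τ F) :
    ArithGate F τ k → MvPolynomial τ F
  | .const c => MvPolynomial.C c
  | .var x => MvPolynomial.X x
  | .add i j => v i + v j
  | .mul i j => v i * v j

theorem ArithGate.value_congr {k : ℕ} {v w : ℕ → MvPolynomial τ F} (h : ∀ i < k, v i = w i)
    (g : ArithGate F τ k) : g.value v = g.value w := by
  cases g with
  | const c => rfl
  | var x => rfl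
  | add i j => simp [ArithGate.value, h i i.2, h j j.2]
  | mul i j => simp [ArithGate.value, h i i.2, h j j.2]

theorem ArithCircuit.value_eq_gate_value (C : ArithCircuit F τ) (i : Fin C.size) :
    C.value i = (C.gate i).value fun j => if h : j < C.size then C.value ⟨j, h⟩ else 0 := by
  conv_lhs => rw [ArithCircuit.value]
  cases C.gate i with
  | const c => rfl
  | var x => rfl
  | add j k => simp [ArithGate.value, j.2.trans i.2, k.2.trans i.2]
  | mul j k => simp [ArithGate.value, j.2.trans i.2, k.2.trans i.2]

end GateValue

section Substitution

variable {F : Type*} [Field F]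

/-- The element of the polynomial ring that a constant or a variable stands for. -/
noncomputable def substValue {τ : Type*} : F ⊕ τ → MvPolynomial τ F :=
  Sum.elim MvPolynomial.C MvPolynomial.X

theorem totalDegree_substValue_le {τ : Type*} (z : F ⊕ τ) : (substValue z).totalDegree ≤ 1 := by
  rcases z with c | x
  · simp [substValue]
  · simp [substValue]

theorem MvPolynomial.totalDegree_aeval_le {τ υ : Type*} (g : υ → MvPolynomial τ F)
    (hg : ∀ y, (g y).totalDegree ≤ 1) (p : MvPolynomial υ F) :
    (aeval g p).totalDegree ≤ p.totalDegree := by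
  rw [aeval_def, eval₂_eq]
  refine totalDegree_finsetSum_le fun d hd => ?_
  refine (totalDegree_mul _ _).trans ?_
  rw [MvPolynomial.algebraMap_eq, totalDegree_C, zero_add]
  refine (totalDegree_finsetProd _ _).trans ?_
  refine le_trans (Finset.sum_le_sum fun i _ => ?_) (le_totalDegree hd)
  exact (totalDegree_pow _ _).trans (by simpa using Nat.mul_le_mul_left (d i) (hg i))

/-- Substitute constants and variables for the variables of a gate. -/
def ArithGate.subst {τ υ : Type*} {k : ℕ} (s : υ → F ⊕ τ) : ArithGate F υ k → ArithGate F τ k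
  | .const c => .const c
  | .var y => Sum.elim .const .var (s y)
  | .add i j => .add i j
  | .mul i j => .mul i j

/-- Substitute constants and variables for the variables of a circuit. -/
def ArithCircuit.subst {τ υ : Type*} (C : ArithCircuit F υ) (s : υ → F ⊕ τ) :
    ArithCircuit F τ where
  size := C.size
  gate i := (C.gate i).subst s
  output := C.output

theorem ArithCircuit.value_subst {τ υ : Type*} (C : ArithCircuit F υ) (s : υ → F ⊕ τ)
    (i : Fin C.size) :
    (C.subst s).value i = MvPolynomial.aeval (fun y => substValue (s y)) (C.value i) := by
  obtain ⟨i, hi⟩ := i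
  induction i using Nat.strong_induction_on with
  | _ i ih =>
    refine ((C.subst s).value_eq_gate_value ⟨i, hi⟩).trans ?_
    rw [C.value_eq_gate_value]
    have hg : (C.subst s).gate ⟨i, hi⟩ = (C.gate ⟨i, hi⟩).subst s := rfl
    have ih' : ∀ j < i, (if h : j < C.size then (C.subst s).value ⟨j, h⟩ else 0) =
        MvPolynomial.aeval (fun y => substValue (s y))
          (if h : j < C.size then C.value ⟨j, h⟩ else 0) := by
      intro j hj
      rw [dif_pos (hj.trans hi), dif_pos (hj.trans hi)]
      exact ih j hj _
    rw [hg]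
    cases C.gate ⟨i, hi⟩ with
    | const c => simp [ArithGate.subst, ArithGate.value]
    | var y =>
      rcases h : s y with c | x <;> simp [ArithGate.subst, ArithGate.value, h, substValue]
    | add j k =>
      simp only [ArithGate.subst, ArithGate.value, map_add]
      exact congrArg₂ _ (ih' j j.2) (ih' k k.2)
    | mul j k =>
      simp only [ArithGate.subst, ArithGate.value, map_mul]
      exact congrArg₂ _ (ih' j j.2) (ih' k k.2)

/-- Substituting constants and variables at the input gates keeps the size of a circuit and does not
raise the degree. -/
theorem IsVP.of_isPProjection {τ υ : ℕ → Type*} {f : ∀ n, MvPolynomial (τ n) F}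
    {g : ∀ n, MvPolynomial (υ n) F} (hg : IsVP g) (h : IsPProjection f g) : IsVP f := by
  obtain ⟨r, hr⟩ := h
  obtain ⟨hdeg, C, hC, hsize⟩ := hg
  choose s hs using hr
  refine ⟨(hdeg.comp_eval r).mono fun n => ?_, fun n => (C (r.eval n)).subst (s n), fun n => ?_,
    hsize.comp_eval r⟩
  · rw [hs n]
    exact MvPolynomial.totalDegree_aeval_le _ (fun y => totalDegree_substValue_le (s n y)) _
  · rw [hs n, ← hC (r.eval n)]
    exact ArithCircuit.value_subst _ _ _

end Substitution

/-! ### Straight-line programs and the cost of extending them -/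

section StraightLine

variable {F : Type*} [Field F] {τ : Type*}

/-- Straight-line programs, listed by the polynomials they compute, the last one first. -/
inductive IsStraightLine : List (MvPolynomial τ F) → Prop
  | nil : IsStraightLine []
  | const (c : F) {L : List (MvPolynomial τ F)} : IsStraightLine L →
      IsStraightLine (MvPolynomial.C c :: L)
  | var (x : τ) {L : List (MvPolynomial τ F)} : IsStraightLine L →
      IsStraightLine (MvPolynomial.X x :: L)
  | add {p q : MvPolynomial τ F} {L : List (MvPolynomial τ F)} : IsStraightLine L → p ∈ L → q ∈ L →
      IsStraightLine ((p + q) :: L)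
  | mul {p q : MvPolynomial τ F} {L : List (MvPolynomial τ F)} : IsStraightLine L → p ∈ L → q ∈ L →
      IsStraightLine ((p * q) :: L)

theorem List.exists_getD_reverse_of_mem {α : Type*} {L : List α} {a : α} (d : α) (h : a ∈ L) :
    ∃ i : Fin L.length, L.reverse.getD i d = a := by
  obtain ⟨i, hi, rfl⟩ := List.getElem_of_mem (List.mem_reverse.2 h)
  exact ⟨⟨i, by simpa using hi⟩, by rw [List.getD_eq_getElem _ _ hi]⟩

/-- After reversal the position of an entry does not change when the program is extended, so it can
serve as a gate number. The default `0` is never reached by the operands. -/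
theorem IsStraightLine.exists_gate {L : List (MvPolynomial τ F)} (hL : IsStraightLine L) :
    ∀ i < L.length, ∃ g : ArithGate F τ i,
      g.value (fun j => L.reverse.getD j 0) = L.reverse.getD i 0 := by
  have key : ∀ (p : MvPolynomial τ F) (L : List (MvPolynomial τ F)),
      (∀ i < L.length, ∃ g : ArithGate F τ i,
        g.value (fun j => L.reverse.getD j 0) = L.reverse.getD i 0) →
      (∃ g : ArithGate F τ L.length, g.value (fun j => L.reverse.getD j 0) = p) →
      ∀ i < (p :: L).length, ∃ g : ArithGate F τ i,
        g.value (fun j => (p :: L).reverse.getD j 0) = (p :: L).reverse.getD i 0 := by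
    intro p L ih hp i hi
    have hlt : ∀ j < L.length, (p :: L).reverse.getD j 0 = L.reverse.getD j 0 := by
      intro j hj
      rw [List.reverse_cons, List.getD_append _ _ _ _ (by simpa using hj)]
    rcases Nat.lt_or_ge i L.length with h | h
    · obtain ⟨g, hg⟩ := ih i h
      refine ⟨g, ?_⟩
      rw [hlt i h, ← hg]
      exact g.value_congr fun j hj => hlt j (hj.trans h)
    · obtain rfl : i = L.length := by simp at hi; omega
      obtain ⟨g, hg⟩ := hp
      refine ⟨g, ?_⟩
      rw [g.value_congr hlt, hg, List.reverse_cons,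
        List.getD_append_right _ _ _ _ (by simp)]
      simp
  induction hL with
  | nil => intro i hi; simp at hi
  | const c h ih => exact key _ _ ih ⟨.const c, rfl⟩
  | var x h ih => exact key _ _ ih ⟨.var x, rfl⟩
  | add h hp hq ih =>
    obtain ⟨i, hi⟩ := List.exists_getD_reverse_of_mem 0 hp
    obtain ⟨j, hj⟩ := List.exists_getD_reverse_of_mem 0 hq
    exact key _ _ ih ⟨.add i j, by simp only [ArithGate.value]; rw [hi, hj]⟩
  | mul h hp hq ih =>
    obtain ⟨i, hi⟩ := List.exists_getD_reverse_of_mem 0 hp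
    obtain ⟨j, hj⟩ := List.exists_getD_reverse_of_mem 0 hq
    exact key _ _ ih ⟨.mul i j, by simp only [ArithGate.value]; rw [hi, hj]⟩

theorem IsStraightLine.exists_circuit {L : List (MvPolynomial τ F)} (hL : IsStraightLine L)
    {p : MvPolynomial τ F} (hp : p ∈ L) :
    ∃ C : ArithCircuit F τ, C.poly = p ∧ C.size = L.length := by
  choose g hg using hL.exists_gate
  obtain ⟨o, ho⟩ := List.exists_getD_reverse_of_mem 0 hp
  let C : ArithCircuit F τ := ⟨L.length, fun i => g i i.2, o⟩
  refine ⟨C, ?_, rfl⟩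
  have hval : ∀ i (hi : i < L.length), C.value ⟨i, hi⟩ = L.reverse.getD i 0 := by
    intro i
    induction i using Nat.strong_induction_on with
    | _ i ih =>
      intro hi
      rw [← hg i hi, ArithCircuit.value_eq_gate_value]
      refine ArithGate.value_congr (fun j hj => ?_) (g i hi)
      rw [dif_pos (show j < C.size from hj.trans hi)]
      exact ih j hj _
  exact (hval o o.2).trans ho

/-- Every straight-line program that contains `L` can be extended by at most `c` operations
to one that computes `p`. -/
def CostLE (L : List (MvPolynomial τ F)) (c : ℕ) (p : MvPolynomial τ F) : Prop :=
  ∀ L', IsStraightLine L' → L ⊆ L' →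
    ∃ L'', IsStraightLine L'' ∧ L' ⊆ L'' ∧ L''.length ≤ L'.length + c ∧ p ∈ L''

namespace CostLE

variable {L : List (MvPolynomial τ F)} {c c' : ℕ} {p q : MvPolynomial τ F}

theorem of_mem (h : p ∈ L) : CostLE L 0 p :=
  fun L' hL' hsub => ⟨L', hL', List.Subset.refl _, le_rfl, hsub h⟩

theorem mono (h : CostLE L c p) (hc : c ≤ c') : CostLE L c' p := by
  intro L' hL' hsub
  obtain ⟨L'', h₁, h₂, h₃, h₄⟩ := h L' hL' hsub
  exact ⟨L'', h₁, h₂, by omega, h₄⟩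

theorem const (a : F) : CostLE L 1 (MvPolynomial.C a) :=
  fun L' hL' _ => ⟨_, .const a hL', List.subset_cons_self _ _, by simp, by simp⟩

theorem var (x : τ) : CostLE L 1 (MvPolynomial.X x : MvPolynomial τ F) :=
  fun L' hL' _ => ⟨_, .var x hL', List.subset_cons_self _ _, by simp, by simp⟩

theorem add (hp : CostLE L c p) (hq : CostLE L c' q) : CostLE L (c + c' + 1) (p + q) := by
  intro L' hL' hsub
  obtain ⟨L₁, h₁, hs₁, hl₁, hp₁⟩ := hp L' hL' hsub
  obtain ⟨L₂, h₂, hs₂, hl₂, hq₂⟩ := hq L₁ h₁ (List.Subset.trans hsub hs₁)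
  exact ⟨_, .add h₂ (hs₂ hp₁) hq₂, List.Subset.trans (List.Subset.trans hs₁ hs₂)
    (List.subset_cons_self _ _),
    by simp only [List.length_cons]; omega, by simp⟩

theorem mul (hp : CostLE L c p) (hq : CostLE L c' q) : CostLE L (c + c' + 1) (p * q) := by
  intro L' hL' hsub
  obtain ⟨L₁, h₁, hs₁, hl₁, hp₁⟩ := hp L' hL' hsub
  obtain ⟨L₂, h₂, hs₂, hl₂, hq₂⟩ := hq L₁ h₁ (List.Subset.trans hsub hs₁)
  exact ⟨_, .mul h₂ (hs₂ hp₁) hq₂, List.Subset.trans (List.Subset.trans hs₁ hs₂)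
    (List.subset_cons_self _ _),
    by simp only [List.length_cons]; omega, by simp⟩

theorem sum {ι : Type*} (s : Finset ι) (g : ι → MvPolynomial τ F)
    (h : ∀ i ∈ s, CostLE L c (g i)) : CostLE L (s.card * (c + 1) + 1) (∑ i ∈ s, g i) := by
  classical
  induction s using Finset.induction_on with
  | empty => simpa using (const (L := L) (0 : F))
  | insert a s ha ih =>
    rw [Finset.sum_insert ha, Finset.card_insert_of_notMem ha]
    refine ((h a (Finset.mem_insert_self _ _)).add
      (ih fun i hi => h i (Finset.mem_insert_of_mem hi))).mono ?_
    ring_nf; omega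

theorem prod {ι : Type*} (s : Finset ι) (g : ι → MvPolynomial τ F)
    (h : ∀ i ∈ s, CostLE L c (g i)) : CostLE L (s.card * (c + 1) + 1) (∏ i ∈ s, g i) := by
  classical
  induction s using Finset.induction_on with
  | empty => simpa using (const (L := L) (1 : F))
  | insert a s ha ih =>
    rw [Finset.prod_insert ha, Finset.card_insert_of_notMem ha]
    refine ((h a (Finset.mem_insert_self _ _)).mul
      (ih fun i hi => h i (Finset.mem_insert_of_mem hi))).mono ?_
    ring_nf; omega

theorem exists_extension {ι : Type*} (s : Finset ι) (g : ι → MvPolynomial τ F)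
    (h : ∀ i ∈ s, CostLE L c (g i)) (hL : IsStraightLine L) :
    ∃ L', IsStraightLine L' ∧ L ⊆ L' ∧ L'.length ≤ L.length + s.card * c ∧ ∀ i ∈ s, g i ∈ L' := by
  classical
  induction s using Finset.induction_on with
  | empty => exact ⟨L, hL, List.Subset.refl _, by simp, by simp⟩
  | insert a s ha ih =>
    obtain ⟨L₁, h₁, hs₁, hl₁, hm₁⟩ := ih fun i hi => h i (Finset.mem_insert_of_mem hi)
    obtain ⟨L₂, h₂, hs₂, hl₂, hm₂⟩ := h a (Finset.mem_insert_self _ _) L₁ h₁ hs₁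
    refine ⟨L₂, h₂, List.Subset.trans hs₁ hs₂, ?_, fun i hi => ?_⟩
    · rw [Finset.card_insert_of_notMem ha]; ring_nf at *; omega
    · rcases Finset.mem_insert.1 hi with rfl | hi
      · exact hm₂
      · exact hs₂ (hm₁ i hi)

end CostLE

end StraightLine

/-! ### Running intersection, independent sets and edge covers -/

section RunningIntersection

variable {α : Type*} [DecidableEq α]

/-- The union of a list of finite sets. -/
def listUnion (l : List (Finset α)) : Finset α := l.foldr (· ∪ ·) ∅

@[simp] theorem listUnion_nil : listUnion ([] : List (Finset α)) = ∅ := rfl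

@[simp] theorem listUnion_cons (e : Finset α) (l : List (Finset α)) :
    listUnion (e :: l) = e ∪ listUnion l := rfl

theorem mem_listUnion {l : List (Finset α)} {x : α} : x ∈ listUnion l ↔ ∃ e ∈ l, x ∈ e := by
  induction l with
  | nil => simp
  | cons e l ih => simp [ih]

theorem subset_listUnion {l : List (Finset α)} {e : Finset α} (h : e ∈ l) : e ⊆ listUnion l :=
  fun _ hx => mem_listUnion.2 ⟨e, h, hx⟩

/-- The running intersection property: each set meets the union of those after it inside a single
one of them. -/
inductive RunningIntersection : List (Finset α) → Prop
  | nil : RunningIntersection []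
  | cons {e : Finset α} {l : List (Finset α)} : RunningIntersection l →
      (l = [] ∨ ∃ f ∈ l, e ∩ listUnion l ⊆ f) → RunningIntersection (e :: l)

namespace RunningIntersection

/-- A join tree may have any number of nodes, so the length of the list needs a bound. If a set is
kept only when no kept later set contains it, then it has an element outside the one that contains
its overlap, and this element is new to the union. The `+ 1` allows for an empty last set. -/
theorem exists_prune {l : List (Finset α)} (h : RunningIntersection l) :
    ∃ l', RunningIntersection l' ∧ l' ⊆ l ∧ (∀ e ∈ l, ∃ f ∈ l', e ⊆ f) ∧
      l'.length ≤ (listUnion l').card + 1 := by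
  induction h with
  | nil => exact ⟨[], nil, by simp, by simp, by simp⟩
  | @cons e l hl hp ih =>
    obtain ⟨l', h₁, h₂, h₃, h₄⟩ := ih
    by_cases he : ∃ f ∈ l', e ⊆ f
    · refine ⟨l', h₁, List.subset_cons_of_subset _ h₂, ?_, h₄⟩
      intro g hg
      rcases List.mem_cons.1 hg with rfl | hg
      · exact he
      · exact h₃ g hg
    · have hsub : listUnion l' ⊆ listUnion l := by
        intro x hx
        obtain ⟨g, hg, hxg⟩ := mem_listUnion.1 hx
        exact mem_listUnion.2 ⟨g, h₂ hg, hxg⟩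
      have hp' : l' = [] ∨ ∃ f ∈ l', e ∩ listUnion l' ⊆ f := by
        rcases hp with rfl | ⟨f, hf, hef⟩
        · exact Or.inl (List.subset_nil.1 h₂)
        · obtain ⟨f', hf', hff'⟩ := h₃ f hf
          exact Or.inr ⟨f', hf',
            ((Finset.inter_subset_inter_left hsub).trans hef).trans hff'⟩
      refine ⟨e :: l', h₁.cons hp', ?_, ?_, ?_⟩
      · exact List.cons_subset_cons _ h₂
      · intro g hg
        rcases List.mem_cons.1 hg with rfl | hg
        · exact ⟨g, by simp, subset_rfl⟩
        · obtain ⟨f, hf, hgf⟩ := h₃ g hg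
          exact ⟨f, List.mem_cons_of_mem _ hf, hgf⟩
      · rcases hp' with rfl | ⟨f, hf, hef⟩
        · simp
        · obtain ⟨x, hxe, hxf⟩ : ∃ x ∈ e, x ∉ f := by
            by_contra hcon
            push Not at hcon
            exact he ⟨f, hf, hcon⟩
          have hx : x ∉ listUnion l' := fun hx => hxf (hef (Finset.mem_inter.2 ⟨hxe, hx⟩))
          have : (insert x (listUnion l')).card ≤ (listUnion (e :: l')).card := by
            refine Finset.card_le_card ?_
            rw [listUnion_cons]
            exact Finset.insert_subset (Finset.mem_union_left _ hxe) Finset.subset_union_right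
          rw [Finset.card_insert_of_notMem hx] at this
          simp only [List.length_cons]
          omega

/-- In an acyclic hypergraph, every vertex set contains an independent set at least as large as
one of its edge covers. -/
theorem exists_independent_cover {l : List (Finset α)} (h : RunningIntersection l) (X : Finset α)
    (hX : X ⊆ listUnion l) :
    ∃ Y ⊆ X, ∃ K : Finset (Finset α), (∀ e ∈ K, e ∈ l) ∧ K.card ≤ Y.card ∧
      (∀ x ∈ X, ∃ e ∈ K, x ∈ e) ∧ ∀ e ∈ l, ∀ x ∈ Y, ∀ y ∈ Y, x ∈ e → y ∈ e → x = y := by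
  induction h generalizing X with
  | nil =>
    obtain rfl : X = ∅ := by simpa using hX
    exact ⟨∅, by simp, ∅, by simp⟩
  | @cons e l hl hp ih =>
    -- Greedy choice: if some `x ∈ X` lies in the first set `e` only, put `x` into `Y` and `e` into
    -- `K` and go on with `X \ e`. Otherwise `e` can be ignored, since two elements of `Y` in `e`
    -- would both lie in its parent `f`.
    by_cases hne : X ⊆ listUnion l
    · obtain ⟨Y, hY, K, hK, hcard, hcov, hind⟩ := ih X hne
      refine ⟨Y, hY, K, fun g hg => List.mem_cons_of_mem _ (hK g hg), hcard, hcov, ?_⟩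
      intro g hg x hx y hy hxg hyg
      rcases List.mem_cons.1 hg with rfl | hg
      · rcases hp with rfl | ⟨f, hf, hef⟩
        · simpa using hne (hY hx)
        · exact hind f hf x hx y hy (hef (Finset.mem_inter.2 ⟨hxg, hne (hY hx)⟩))
            (hef (Finset.mem_inter.2 ⟨hyg, hne (hY hy)⟩))
      · exact hind g hg x hx y hy hxg hyg
    · obtain ⟨x, hxX, hxl⟩ := Finset.not_subset.1 hne
      have hxe : x ∈ e := by
        rcases Finset.mem_union.1 (hX hxX) with h | h
        · exact h
        · exact absurd h hxl
      obtain ⟨Y, hY, K, hK, hcard, hcov, hind⟩ := ih (X \ e) (by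
        intro z hz
        obtain ⟨hz₁, hz₂⟩ := Finset.mem_sdiff.1 hz
        exact (Finset.mem_union.1 (hX hz₁)).resolve_left hz₂)
      have hYe : ∀ y ∈ Y, y ∉ e := fun y hy => (Finset.mem_sdiff.1 (hY hy)).2
      refine ⟨insert x Y, ?_, insert e K, ?_, ?_, ?_, ?_⟩
      · exact Finset.insert_subset hxX (hY.trans Finset.sdiff_subset)
      · intro g hg
        rcases Finset.mem_insert.1 hg with rfl | hg
        · simp
        · exact List.mem_cons_of_mem _ (hK g hg)
      · rw [Finset.card_insert_of_notMem fun hxY => hYe x hxY hxe]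
        exact (Finset.card_insert_le _ _).trans (by omega)
      · intro z hz
        by_cases hze : z ∈ e
        · exact ⟨e, Finset.mem_insert_self _ _, hze⟩
        · obtain ⟨g, hg, hzg⟩ := hcov z (Finset.mem_sdiff.2 ⟨hz, hze⟩)
          exact ⟨g, Finset.mem_insert_of_mem hg, hzg⟩
      · intro g hg y hy z hz hyg hzg
        rcases List.mem_cons.1 hg with rfl | hg
        · rcases Finset.mem_insert.1 hy with rfl | hy
          · rcases Finset.mem_insert.1 hz with rfl | hz
            · rfl
            · exact absurd hzg (hYe z hz)
          · exact absurd hyg (hYe y hy)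
        · have hxg : x ∉ g := fun hxg => hxl (subset_listUnion hg hxg)
          rcases Finset.mem_insert.1 hy with rfl | hy
          · exact absurd hyg hxg
          · rcases Finset.mem_insert.1 hz with rfl | hz
            · exact absurd hzg hxg
            · exact hind g hg y hy z hz hyg hzg

end RunningIntersection

/-- A walk enters and leaves the leaf `a` through its only neighbour `p`, so visits to `a` can be
cut out. The induction along the walk replaces the current vertex by `p` whenever it is `a`. -/
theorem SimpleGraph.Preconnected.induce_compl_leaf {ι : Type*} {T : SimpleGraph ι} {a p : ι}
    (hp : ∀ b, T.Adj a b → b = p) {s : Set ι} (hs : (T.induce s).Preconnected) :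
    ((T.induce ({a}ᶜ : Set ι)).induce {t : ({a}ᶜ : Set ι) | (t : ι) ∈ s}).Preconnected := by
  rintro ⟨⟨u, hu⟩, hus⟩ ⟨⟨v, hv⟩, hvs⟩
  have hr := (SimpleGraph.reachable_iff_reflTransGen _ _).1 (hs ⟨u, hus⟩ ⟨v, hvs⟩)
  have hclaim : ∀ c : s, Relation.ReflTransGen (T.induce s).Adj c ⟨v, hvs⟩ →
      (∀ hc : (c : ι) ∈ ({a}ᶜ : Set ι),
        ((T.induce ({a}ᶜ : Set ι)).induce {t : ({a}ᶜ : Set ι) | (t : ι) ∈ s}).Reachable ⟨⟨c, hc⟩, c.2⟩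
          ⟨⟨v, hv⟩, hvs⟩) ∧
      ((c : ι) = a → ∀ (hpa : p ∈ ({a}ᶜ : Set ι)) (hps : p ∈ s),
        ((T.induce ({a}ᶜ : Set ι)).induce {t : ({a}ᶜ : Set ι) | (t : ι) ∈ s}).Reachable ⟨⟨p, hpa⟩, hps⟩
          ⟨⟨v, hv⟩, hvs⟩) := by
    intro c hc
    induction hc using Relation.ReflTransGen.head_induction_on with
    | refl => exact ⟨fun _ => SimpleGraph.Reachable.refl _, fun h => absurd h hv⟩
    | @head c d hcd _ ih =>
      have hadj : T.Adj c d := hcd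
      constructor
      · intro hc
        by_cases hd : (d : ι) = a
        · have hcp : (c : ι) = p := hp c (hd ▸ hadj.symm)
          obtain ⟨c, hcs⟩ := c
          subst hcp
          exact ih.2 hd hc hcs
        · refine SimpleGraph.Reachable.trans (SimpleGraph.Adj.reachable ?_) (ih.1 hd)
          exact hadj
      · intro hca hpa hps
        have hdp : (d : ι) = p := hp d (hca ▸ hadj)
        obtain ⟨d, hds⟩ := d
        subst hdp
        exact ih.1 hpa
  exact (hclaim ⟨u, hus⟩ hr).1 hu

/-- The bags of a tree decomposition can be listed with the running intersection property. -/
theorem SimpleGraph.IsTree.exists_runningIntersection (n : ℕ) :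
    ∀ {ι : Type} [Fintype ι] {T : SimpleGraph ι}, Fintype.card ι = n → T.IsTree →
    ∀ bag : ι → Finset α, (∀ v, (T.induce {t | v ∈ bag t}).Preconnected) →
    ∃ l, RunningIntersection l ∧ ∀ e, e ∈ l ↔ ∃ t, bag t = e := by
  classical
  induction n with
  | zero =>
    intro ι _ T hcard hT
    have := hT.connected.nonempty
    exact absurd hcard Fintype.card_ne_zero
  | succ n ih =>
    intro ι _ T hcard hT bag hconn
    rcases subsingleton_or_nontrivial ι with hs | hs
    · obtain ⟨t₀⟩ := hT.connected.nonempty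
      refine ⟨[bag t₀], .cons .nil (Or.inl rfl), fun e => ?_⟩
      rw [List.mem_singleton]
      exact ⟨fun h => ⟨t₀, h.symm⟩, fun ⟨t, ht⟩ => by rw [← ht, Subsingleton.elim t t₀]⟩
    · obtain ⟨a, ha⟩ := hT.exists_vert_degree_one_of_nontrivial
      obtain ⟨p, hap, hp⟩ := SimpleGraph.degree_eq_one_iff_existsUnique_adj.1 ha
      have hpa : p ∈ ({a}ᶜ : Set ι) := hap.ne'
      have hT' : (T.induce ({a}ᶜ : Set ι)).IsTree :=
        ⟨hT.connected.induce_compl_singleton_of_degree_eq_one ha, hT.isAcyclic.induce _⟩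
      obtain ⟨l, hl, hmem⟩ := ih (ι := ({a}ᶜ : Set ι))
        (by rw [Fintype.card_compl_set]; simp [hcard]) hT' (fun t => bag t)
        (fun v => SimpleGraph.Preconnected.induce_compl_leaf hp (hconn v))
      refine ⟨bag a :: l, hl.cons (Or.inr ⟨bag p, (hmem _).2 ⟨⟨p, hpa⟩, rfl⟩, ?_⟩), fun e => ?_⟩
      -- The nodes whose bags contain `v` are connected and include the leaf `a` and another node,
      -- so a walk between these goes through `p`.
      · intro v hv
        obtain ⟨hva, hvl⟩ := Finset.mem_inter.1 hv
        obtain ⟨e, he, hve⟩ := mem_listUnion.1 hvl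
        obtain ⟨⟨t, hta⟩, rfl⟩ := (hmem e).1 he
        have hr := (SimpleGraph.reachable_iff_reflTransGen _ _).1 (hconn v ⟨a, hva⟩ ⟨t, hve⟩)
        rcases Relation.ReflTransGen.cases_head hr with h | ⟨⟨c, hc⟩, hac, -⟩
        · exact absurd (congrArg Subtype.val h).symm hta
        · obtain rfl : c = p := hp c hac
          exact hc
      · rw [List.mem_cons, hmem]
        constructor
        · rintro (rfl | ⟨t, rfl⟩)
          · exact ⟨a, rfl⟩
          · exact ⟨t, rfl⟩
        · rintro ⟨t, rfl⟩
          by_cases hta : t = a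
          · exact Or.inl (by rw [hta])
          · exact Or.inr ⟨⟨t, hta⟩, rfl⟩

end RunningIntersection

/-! ### Summation by eliminating one bag at a time -/

section TreeSum

variable {V D : Type*} [DecidableEq V] (d₀ : D)

/-- Change the values outside `U` to `d₀`. -/
def restrictTo (U : Finset V) (a : V → D) : V → D := fun x => if x ∈ U then a x else d₀

theorem restrictTo_of_mem {U : Finset V} {a : V → D} {x : V} (h : x ∈ U) :
    restrictTo d₀ U a x = a x := if_pos h

theorem restrictTo_of_notMem {U : Finset V} {a : V → D} {x : V} (h : x ∉ U) :
    restrictTo d₀ U a x = d₀ := if_neg h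

theorem restrictTo_congr {U : Finset V} {a b : V → D} (h : ∀ x ∈ U, a x = b x) :
    restrictTo d₀ U a = restrictTo d₀ U b := by
  funext x
  by_cases hx : x ∈ U
  · rw [restrictTo_of_mem _ hx, restrictTo_of_mem _ hx, h x hx]
  · rw [restrictTo_of_notMem _ hx, restrictTo_of_notMem _ hx]

theorem extendBy_injective (U : Finset V) :
    Function.Injective fun (b : U → D) (x : V) => if h : x ∈ U then b ⟨x, h⟩ else d₀ := by
  intro b c h
  funext ⟨x, hx⟩
  simpa [hx] using congrFun h x

/-- A function of assignments depends only on the values on `U`. -/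
def DependsOnlyOn {R : Type*} (w : (V → D) → R) (U : Finset V) : Prop :=
  ∀ a b : V → D, (∀ x ∈ U, a x = b x) → w a = w b

theorem DependsOnlyOn.list_prod {R : Type*} [CommSemiring R]
    (l : List (Finset V × ((V → D) → R))) (h : ∀ p ∈ l, DependsOnlyOn p.2 p.1) :
    DependsOnlyOn (fun a => (l.map fun p => p.2 a).prod) (listUnion (l.map Prod.fst)) := by
  intro a b hab
  refine congrArg List.prod (List.map_congr_left fun p hp => h p hp a b fun x hx => hab x ?_)
  exact subset_listUnion (List.mem_map_of_mem hp) hx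

variable [Fintype D]

/-- The assignments of the variables in `U`, extended by `d₀`. -/
def assignments (U : Finset V) : Finset (V → D) :=
  Finset.univ.map ⟨fun (b : U → D) (x : V) => if h : x ∈ U then b ⟨x, h⟩ else d₀,
    extendBy_injective d₀ U⟩

theorem mem_assignments {U : Finset V} {a : V → D} :
    a ∈ assignments d₀ U ↔ ∀ x ∉ U, a x = d₀ := by
  simp only [assignments, Finset.mem_map, Finset.mem_univ, true_and, Function.Embedding.coeFn_mk]
  constructor
  · rintro ⟨b, rfl⟩ x hx
    simp [hx]
  · intro h
    refine ⟨fun x => a x, ?_⟩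
    funext x
    by_cases hx : x ∈ U
    · simp [hx]
    · simp [hx, h x hx]

theorem restrictTo_mem_assignments (U : Finset V) (a : V → D) :
    restrictTo d₀ U a ∈ assignments d₀ U :=
  (mem_assignments d₀).2 fun _ hx => restrictTo_of_notMem d₀ hx

theorem restrictTo_eq_self {U : Finset V} {a : V → D} (h : a ∈ assignments d₀ U) :
    restrictTo d₀ U a = a := by
  funext x
  by_cases hx : x ∈ U
  · exact restrictTo_of_mem _ hx
  · rw [restrictTo_of_notMem _ hx, (mem_assignments d₀).1 h x hx]

theorem mem_assignments_ext {U : Finset V} {a b : V → D} (ha : a ∈ assignments d₀ U)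
    (hb : b ∈ assignments d₀ U) (h : ∀ x ∈ U, a x = b x) : a = b := by
  rw [← restrictTo_eq_self d₀ ha, ← restrictTo_eq_self d₀ hb, restrictTo_congr d₀ h]

open scoped Classical in
/-- The sum over the values of the variables in `e \ U`, as a function of the variables in
`e ∩ U`. -/
noncomputable def marginal {R : Type*} [CommSemiring R] (X : D → R) (e U : Finset V)
    (w : (V → D) → R) (b : V → D) : R :=
  ∑ q ∈ assignments d₀ e with ∀ x ∈ e ∩ U, q x = b x, (∏ x ∈ e \ U, X (q x)) * w q

theorem dependsOnlyOn_marginal {R : Type*} [CommSemiring R] (X : D → R) (e U : Finset V)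
    (w : (V → D) → R) : DependsOnlyOn (marginal d₀ X e U w) (e ∩ U) := by
  classical
  intro a b h
  unfold marginal
  refine Finset.sum_congr (Finset.filter_congr fun q _ => ?_) fun _ _ => rfl
  exact forall₂_congr fun x hx => by rw [h x hx]

/-- Group the assignments of `e ∪ U` by their restriction `b` to `U`. What remains to be chosen is
an assignment of `e` that agrees with `b` on `e ∩ U`, and only the variables in `e \ U` still
contribute a factor `X`. -/
theorem sum_assignments_union {R : Type*} [CommSemiring R] (X : D → R) (e U : Finset V)
    {w g : (V → D) → R} (hw : DependsOnlyOn w e) (hg : DependsOnlyOn g U) :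
    ∑ a ∈ assignments d₀ (e ∪ U), (∏ x ∈ e ∪ U, X (a x)) * (w a * g a) =
      ∑ b ∈ assignments d₀ U, (∏ x ∈ U, X (b x)) * (g b * marginal d₀ X e U w b) := by
  classical
  rw [← Finset.sum_fiberwise_of_maps_to (s := assignments d₀ (e ∪ U)) (t := assignments d₀ U)
    (g := restrictTo d₀ U) fun a _ => restrictTo_mem_assignments d₀ U a]
  refine Finset.sum_congr rfl fun b hb => ?_
  rw [marginal, Finset.mul_sum, Finset.mul_sum]
  refine Finset.sum_bij' (fun a _ => restrictTo d₀ e a)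
    (fun q _ x => if x ∈ U then b x else q x) ?_ ?_ ?_ ?_ ?_
  · intro a ha
    obtain ⟨ha, rfl⟩ := Finset.mem_filter.1 ha
    refine Finset.mem_filter.2 ⟨restrictTo_mem_assignments d₀ e a, fun x hx => ?_⟩
    obtain ⟨h₁, h₂⟩ := Finset.mem_inter.1 hx
    rw [restrictTo_of_mem _ h₁, restrictTo_of_mem _ h₂]
  · intro q hq
    obtain ⟨hq, hqb⟩ := Finset.mem_filter.1 hq
    refine Finset.mem_filter.2 ⟨(mem_assignments d₀).2 fun x hx => ?_, ?_⟩
    · rw [Finset.mem_union, not_or] at hx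
      rw [if_neg hx.2, (mem_assignments d₀).1 hq x hx.1]
    · refine mem_assignments_ext d₀ (restrictTo_mem_assignments d₀ _ _) hb fun x hx => ?_
      rw [restrictTo_of_mem _ hx, if_pos hx]
  · intro a ha
    obtain ⟨ha', rfl⟩ := Finset.mem_filter.1 ha
    refine mem_assignments_ext d₀ ((mem_assignments d₀).2 fun x hx => ?_) ha' fun x hx => ?_
    · rw [Finset.mem_union, not_or] at hx
      rw [if_neg hx.2, restrictTo_of_notMem _ hx.1]
    · by_cases hxU : x ∈ U
      · rw [if_pos hxU, restrictTo_of_mem _ hxU]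
      · rw [if_neg hxU, restrictTo_of_mem _ ((Finset.mem_union.1 hx).resolve_right hxU)]
  · intro q hq
    obtain ⟨hq, hqb⟩ := Finset.mem_filter.1 hq
    refine mem_assignments_ext d₀ (restrictTo_mem_assignments d₀ _ _) hq fun x hx => ?_
    rw [restrictTo_of_mem _ hx]
    by_cases hxU : x ∈ U
    · rw [if_pos hxU, hqb x (Finset.mem_inter.2 ⟨hx, hxU⟩)]
    · rw [if_neg hxU]
  · intro a ha
    obtain ⟨ha, rfl⟩ := Finset.mem_filter.1 ha
    have h₁ : w (restrictTo d₀ e a) = w a := hw _ _ fun x hx => restrictTo_of_mem d₀ hx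
    have h₂ : g (restrictTo d₀ U a) = g a := hg _ _ fun x hx => restrictTo_of_mem d₀ hx
    have h₃ : ∏ x ∈ U, X (restrictTo d₀ U a x) = ∏ x ∈ U, X (a x) :=
      Finset.prod_congr rfl fun x hx => by rw [restrictTo_of_mem _ hx]
    have h₄ : ∏ x ∈ e \ U, X (restrictTo d₀ e a x) = ∏ x ∈ e \ U, X (a x) :=
      Finset.prod_congr rfl fun x hx => by rw [restrictTo_of_mem _ (Finset.mem_sdiff.1 hx).1]
    rw [h₁, h₂, h₃, h₄, ← Finset.sdiff_union_self_eq_union, Finset.prod_union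
      Finset.sdiff_disjoint]
    ring

variable {F : Type*} [Field F]

/-- The nonzero values of a function of the variables in `U` occur at at most `M` assignments. -/
def SupportCardLE {R : Type*} [Zero R] (w : (V → D) → R) (U : Finset V) (M : ℕ) : Prop :=
  ∃ K : Finset (V → D), K.card ≤ M ∧ ∀ a, w a ≠ 0 → restrictTo d₀ U a ∈ K

/-- At most `M` terms are nonzero. A term is a product of at most `n` variables, at cost `2 * n +
1`, and one multiplication by a weight that the program already contains. -/
theorem costLE_marginal {L : List (MvPolynomial D F)} {e U : Finset V}
    {w : (V → D) → MvPolynomial D F} {M n : ℕ} (hL : ∀ a, w a ∈ L) (hn : e.card ≤ n)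
    (hM : SupportCardLE d₀ w e M) (b : V → D) :
    CostLE L (M * (2 * n + 3) + 1) (marginal d₀ MvPolynomial.X e U w b) := by
  classical
  obtain ⟨K, hK, hKw⟩ := hM
  have hsum : marginal d₀ MvPolynomial.X e U w b =
      ∑ q ∈ K with q ∈ assignments d₀ e ∧ ∀ x ∈ e ∩ U, q x = b x,
        (∏ x ∈ e \ U, (MvPolynomial.X (q x) : MvPolynomial D F)) * w q := by
    symm
    refine Finset.sum_subset (fun q hq => ?_) fun q hq hq' => ?_
    · exact Finset.mem_filter.2 (Finset.mem_filter.1 hq).2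
    · by_contra hne
      have hq₂ := Finset.mem_filter.1 hq
      refine hq' (Finset.mem_filter.2 ⟨?_, hq₂⟩)
      have := hKw q (right_ne_zero_of_mul hne)
      rwa [restrictTo_eq_self d₀ hq₂.1] at this
  rw [hsum]
  refine (CostLE.sum (c := 2 * n + 2) _ _ fun q _ => ?_).mono ?_
  · refine ((CostLE.prod (c := 1) _ _ fun x _ => CostLE.var _).mul
      (CostLE.of_mem (hL q))).mono ?_
    have : (e \ U).card ≤ n := (Finset.card_le_card Finset.sdiff_subset).trans hn
    omega
  · exact Nat.add_le_add_right (Nat.mul_le_mul_right _ ((Finset.card_filter_le _ _).trans hK)) _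

/-- The first set `e` meets the others inside a single `f`, so its marginal depends on `f` only and
can be absorbed into the weight of `f`. The support of the new weight is no larger, hence the bound
`M` persists and each elimination computes at most `M` new weights. The final `+ 1` pays for the
constant `1`, the sum for the empty list. -/
theorem exists_straightLine_treeSum (n M k : ℕ) :
    ∀ l : List (Finset V × ((V → D) → MvPolynomial D F)), l.length = k →
    RunningIntersection (l.map Prod.fst) →
    (∀ p ∈ l, DependsOnlyOn p.2 p.1 ∧ SupportCardLE d₀ p.2 p.1 M ∧ p.1.card ≤ n) →
    ∀ L, IsStraightLine L → (∀ p ∈ l, ∀ a, p.2 a ∈ L) →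
    ∃ L', IsStraightLine L' ∧ L'.length ≤ L.length + k * ((M + 1) * (M * (2 * n + 3) + 2)) + 1 ∧
      ∑ a ∈ assignments d₀ (listUnion (l.map Prod.fst)),
        (∏ x ∈ listUnion (l.map Prod.fst), MvPolynomial.X (a x)) *
          (l.map fun p => p.2 a).prod ∈ L' := by
  classical
  induction k with
  | zero =>
    intro l hl hRI hp L hL hmem
    obtain rfl := List.length_eq_zero_iff.1 hl
    have hA : assignments d₀ (∅ : Finset V) = {fun _ => d₀} := by
      ext a
      rw [mem_assignments, Finset.mem_singleton, funext_iff]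
      simp
    refine ⟨MvPolynomial.C 1 :: L, .const 1 hL, by simp, ?_⟩
    simp [hA]
  | succ k ih =>
    intro l hl hRI hp L hL hmem
    obtain _ | ⟨⟨e, w⟩, l⟩ := l
    · simp at hl
    obtain ⟨hwe, hwM, hen⟩ : DependsOnlyOn w e ∧ SupportCardLE d₀ w e M ∧ e.card ≤ n :=
      hp (e, w) (by simp)
    have hpl : ∀ p ∈ l, DependsOnlyOn p.2 p.1 ∧ SupportCardLE d₀ p.2 p.1 M ∧ p.1.card ≤ n :=
      fun p h => hp p (List.mem_cons_of_mem _ h)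
    simp only [List.map_cons, listUnion_cons, List.prod_cons] at hRI ⊢
    simp only [List.length_cons, Nat.add_right_cancel_iff] at hl
    set U := listUnion (l.map Prod.fst) with hU
    set s := marginal d₀ (MvPolynomial.X : D → MvPolynomial D F) e U w with hs
    have hcost : ∀ b, CostLE L (M * (2 * n + 3) + 1) (s b) :=
      fun b => costLE_marginal d₀ (fun a => hmem (e, w) (by simp) a) hen hwM b
    rw [sum_assignments_union d₀ _ e U hwe
      (DependsOnlyOn.list_prod l fun p h => (hpl p h).1)]
    cases hRI with
    | cons hRIl hpar =>
    rcases hpar with hnil | ⟨f, hf, hef⟩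
    · obtain rfl := List.map_eq_nil_iff.1 hnil
      have hU₀ : U = ∅ := rfl
      have hA : assignments d₀ (∅ : Finset V) = {fun _ => d₀} := by
        ext a
        rw [mem_assignments, Finset.mem_singleton, funext_iff]
        simp
      obtain ⟨L', h₁, -, h₃, h₄⟩ := hcost (fun _ => d₀) L hL (List.Subset.refl _)
      refine ⟨L', h₁, h₃.trans ?_, ?_⟩
      · have : M * (2 * n + 3) + 2 ≤ (M + 1) * (M * (2 * n + 3) + 2) :=
          Nat.le_mul_of_pos_left _ (Nat.succ_pos M)
        rw [Nat.add_mul, Nat.one_mul]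
        omega
      · rw [hs, hU₀] at h₄
        simpa [hU₀, hA] using h₄
    · obtain ⟨⟨f, wf⟩, hfl, rfl⟩ := List.mem_map.1 hf
      obtain ⟨l₁, l₂, rfl⟩ := List.append_of_mem hfl
      obtain ⟨hwf, ⟨K, hK, hKw⟩, hfn⟩ :
          DependsOnlyOn wf f ∧ SupportCardLE d₀ wf f M ∧ f.card ≤ n := hpl (f, wf) hfl
      have hmemf : ∀ a, wf a ∈ L := fun a => hmem (f, wf) (List.mem_cons_of_mem _ hfl) a
      have hdep : DependsOnlyOn (fun a => wf a * s a) f := by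
        intro a b hab
        change wf a * s a = wf b * s b
        rw [hwf a b hab, hs, dependsOnlyOn_marginal d₀ _ e U w a b fun x hx => hab x (hef hx)]
      obtain ⟨L₁, hL₁, hLL₁, hlen₁, hmem₁⟩ := CostLE.exists_extension (L := L)
        (c := M * (2 * n + 3) + 2) K (fun a => wf a * s a)
        (fun a _ => ((CostLE.of_mem (hmemf a)).mul (hcost a)).mono (by omega)) hL
      set l' := l₁ ++ (f, fun a => wf a * s a) :: l₂ with hl'
      have hfst : l'.map Prod.fst = (l₁ ++ (f, wf) :: l₂).map Prod.fst := by simp [hl']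
      have hcases : ∀ p ∈ l', p = (f, fun a => wf a * s a) ∨ p ∈ l₁ ++ (f, wf) :: l₂ := by
        intro p h
        simp only [hl', List.mem_append, List.mem_cons] at h ⊢
        tauto
      obtain ⟨L', h₁, h₂, h₃⟩ := ih l' (by rw [← hl]; simp [hl']) (hfst ▸ hRIl) (by
          intro p h
          rcases hcases p h with rfl | h
          · exact ⟨hdep, ⟨K, hK, fun a ha => hKw a (left_ne_zero_of_mul ha)⟩, hfn⟩
          · exact hpl p h) L₁ hL₁ (by
          intro p h a
          rcases hcases p h with rfl | h
          -- Off the support the new weight is `0`, which equals `wf a` and is already present. On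
          -- the support its value is that at the restriction of `a` to `f`, one of the assignments
          -- in `K`.
          · by_cases h₀ : wf a = 0
            · change wf a * s a ∈ L₁
              rw [h₀, zero_mul, ← h₀]
              exact hLL₁ (hmemf a)
            · change wf a * s a ∈ L₁
              rw [show wf a * s a = _ from hdep a (restrictTo d₀ f a) fun x hx =>
                (restrictTo_of_mem d₀ hx).symm]
              exact hmem₁ _ (hKw a h₀)
          · exact hLL₁ (hmem p (List.mem_cons_of_mem _ h) a))
      refine ⟨L', h₁, h₂.trans ?_, ?_⟩
      · have : K.card * (M * (2 * n + 3) + 2) ≤ (M + 1) * (M * (2 * n + 3) + 2) :=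
          Nat.mul_le_mul_right _ (by omega)
        rw [Nat.add_mul k 1, Nat.one_mul]
        omega
      · rw [hfst, ← hU] at h₃
        convert h₃ using 3 with a
        simp only [hl', List.map_append, List.map_cons, List.prod_append, List.prod_cons]
        ring

end TreeSum

/-! ### Satisfaction without quantifiers, and counting partial models -/

namespace ConjQuery

variable {σ : Signature}

theorem Arg.eval_congr {S : FinStructure σ} {v w : ℕ → S.Dom} (t : Arg σ)
    (h : ∀ x ∈ t.vars, v x = w x) : t.eval S v = t.eval S w := by
  cases t with
  | var x => exact h x (by simp [Arg.vars])
  | const c => rfl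

theorem Arg.eqOn_of_eval_eq {S : FinStructure σ} {v w : ℕ → S.Dom} (t : Arg σ)
    (h : t.eval S v = t.eval S w) : ∀ x ∈ t.vars, v x = w x := by
  cases t with
  | var x => intro y hy; obtain rfl : y = x := by simpa [Arg.vars] using hy
             exact h
  | const c => intro y hy; simp [Arg.vars] at hy

namespace Formula

/-- Satisfaction of all atoms of a formula, the quantifiers being ignored. -/
def MatrixSat (S : FinStructure σ) : Formula σ → (ℕ → S.Dom) → Prop
  | atom r t, v => (fun i => (t i).eval S v) ∈ S.rel r
  | and φ ψ, v => φ.MatrixSat S v ∧ ψ.MatrixSat S v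
  | ex _ φ, v => φ.MatrixSat S v

theorem free_subset_vars (φ : Formula σ) : φ.free ⊆ φ.vars := by
  induction φ with
  | atom r t => exact subset_rfl
  | and φ ψ ih₁ ih₂ => exact Finset.union_subset_union ih₁ ih₂
  | ex x φ ih => exact ((Finset.erase_subset _ _).trans ih).trans (Finset.subset_insert _ _)

theorem Clean.disjoint_free_bound {φ : Formula σ} (h : φ.Clean) : Disjoint φ.free φ.bound := by
  induction φ with
  | atom r t => simp [bound]
  | and φ ψ ih₁ ih₂ =>
    obtain ⟨h₁, h₂, h₃, h₄⟩ := h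
    simp only [free, bound, Finset.disjoint_union_left, Finset.disjoint_union_right]
    exact ⟨⟨ih₁ h₁, (h₃.symm.mono_left ψ.free_subset_vars)⟩,
      h₄.mono_left φ.free_subset_vars, ih₂ h₂⟩
  | ex x φ ih =>
    simp only [free, bound, Finset.disjoint_insert_right, Finset.mem_erase, ne_eq, not_true,
      false_and, not_false_eq_true, true_and]
    exact (ih h.1).mono_left (Finset.erase_subset _ _)

theorem exists_mem_atomVars_of_mem_free (φ : Formula σ) {x : ℕ} (hx : x ∈ φ.free) :
    ∃ e ∈ φ.atomVars, x ∈ e := by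
  induction φ with
  | atom r t => exact ⟨_, Finset.mem_singleton_self _, hx⟩
  | and φ ψ ih₁ ih₂ =>
    rcases Finset.mem_union.1 hx with h | h
    · obtain ⟨e, he, hxe⟩ := ih₁ h
      exact ⟨e, Finset.mem_union_left _ he, hxe⟩
    · obtain ⟨e, he, hxe⟩ := ih₂ h
      exact ⟨e, Finset.mem_union_right _ he, hxe⟩
  | ex y φ ih => exact ih (Finset.mem_of_mem_erase hx)

theorem card_vars_le_size (φ : Formula σ) : φ.vars.card ≤ φ.size := by
  induction φ with
  | atom r t =>
    refine (Finset.card_biUnion_le_card_mul _ _ 1 fun i _ => ?_).trans ?_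
    · cases t i <;> simp [Arg.vars]
    · simp [size]
  | and φ ψ ih₁ ih₂ =>
    refine (Finset.card_union_le _ _).trans ?_
    simp only [size]
    omega
  | ex x φ ih =>
    refine (Finset.card_insert_le _ _).trans ?_
    simp only [size]
    omega

variable (S : FinStructure σ)

theorem matrixSat_congr (φ : Formula σ) {v w : ℕ → S.Dom} (h : ∀ x ∈ φ.vars, v x = w x) :
    φ.MatrixSat S v ↔ φ.MatrixSat S w := by
  induction φ with
  | atom r t =>
    have : (fun i => (t i).eval S v) = fun i => (t i).eval S w := by
      funext i
      exact Arg.eval_congr _ fun x hx => h x (Finset.mem_biUnion.2 ⟨i, Finset.mem_univ _, hx⟩)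
    simp only [MatrixSat, this]
  | and φ ψ ih₁ ih₂ =>
    exact and_congr (ih₁ fun x hx => h x (Finset.mem_union_left _ hx))
      (ih₂ fun x hx => h x (Finset.mem_union_right _ hx))
  | ex y φ ih => exact ih fun x hx => h x (Finset.mem_insert_of_mem hx)

/-- Prenex form: under the convention on variable names all quantifiers can be moved in front. -/
theorem sat_iff_exists_matrixSat {φ : Formula σ} (h : φ.Clean) (v : ℕ → S.Dom) :
    φ.Sat S v ↔ ∃ w, (∀ x ∉ φ.bound, w x = v x) ∧ φ.MatrixSat S w := by
  induction φ generalizing v with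
  | atom r t =>
    constructor
    · exact fun hs => ⟨v, fun _ _ => rfl, hs⟩
    · rintro ⟨w, hw, hs⟩
      obtain rfl : w = v := funext fun x => hw x (by simp [bound])
      exact hs
  | and φ ψ ih₁ ih₂ =>
    obtain ⟨h₁, h₂, h₃, h₄⟩ := h
    simp only [Sat, ih₁ h₁, ih₂ h₂]
    constructor
    · rintro ⟨⟨w₁, hw₁, hs₁⟩, ⟨w₂, hw₂, hs₂⟩⟩
      -- The two witnesses can be glued because the variables bound in one conjunct do not occur in
      -- the other.
      refine ⟨fun x => if x ∈ φ.bound then w₁ x else w₂ x, ?_, ?_, ?_⟩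
      · intro x hx
        simp only [bound, Finset.mem_union, not_or] at hx
        simp only [if_neg hx.1, hw₂ x hx.2]
      · refine (matrixSat_congr S φ fun x hx => ?_).1 hs₁
        by_cases hb : x ∈ φ.bound
        · simp only [if_pos hb]
        · simp only [if_neg hb]
          rw [hw₁ x hb, hw₂ x (Finset.disjoint_left.1 h₄ hx)]
      · refine (matrixSat_congr S ψ fun x hx => ?_).1 hs₂
        simp only [if_neg (Finset.disjoint_right.1 h₃ hx)]
    · rintro ⟨w, hw, hs₁, hs₂⟩
      refine ⟨⟨fun x => if x ∈ φ.bound then w x else v x, fun x hx => if_neg hx, ?_⟩,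
        ⟨fun x => if x ∈ ψ.bound then w x else v x, fun x hx => if_neg hx, ?_⟩⟩
      · refine (matrixSat_congr S φ fun x hx => ?_).1 hs₁
        by_cases hb : x ∈ φ.bound
        · simp only [if_pos hb]
        · simp only [if_neg hb]
          refine hw x ?_
          simp only [bound, Finset.mem_union, not_or]
          exact ⟨hb, Finset.disjoint_left.1 h₄ hx⟩
      · refine (matrixSat_congr S ψ fun x hx => ?_).1 hs₂
        by_cases hb : x ∈ ψ.bound
        · simp only [if_pos hb]
        · simp only [if_neg hb]
          refine hw x ?_
          simp only [bound, Finset.mem_union, not_or]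
          exact ⟨Finset.disjoint_right.1 h₃ hx, hb⟩
  | ex y φ ih =>
    simp only [Sat, ih h.1]
    constructor
    · rintro ⟨d, w, hw, hs⟩
      refine ⟨w, fun x hx => ?_, hs⟩
      simp only [bound, Finset.mem_insert, not_or] at hx
      rw [hw x hx.2, Function.update_of_ne hx.1]
    · rintro ⟨w, hw, hs⟩
      refine ⟨w y, w, fun x hx => ?_, hs⟩
      by_cases hxy : x = y
      · subst hxy; simp
      · rw [Function.update_of_ne hxy]
        exact hw x (by simp [bound, hxy, hx])

/-- Each atom tests its own variables only, so a different model may serve as the witness for each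
atom. -/
theorem matrixSat_of_forall_atomVars (φ : Formula σ) (v : ℕ → S.Dom)
    (h : ∀ e ∈ φ.atomVars, ∃ w, φ.MatrixSat S w ∧ ∀ x ∈ e, w x = v x) : φ.MatrixSat S v := by
  induction φ with
  | atom r t =>
    obtain ⟨w, hw, hwv⟩ := h _ (Finset.mem_singleton_self _)
    exact (matrixSat_congr S (atom r t) hwv).1 hw
  | and φ ψ ih₁ ih₂ =>
    constructor
    · refine ih₁ fun e he => ?_
      obtain ⟨w, hw, hwv⟩ := h e (Finset.mem_union_left _ he)
      exact ⟨w, hw.1, hwv⟩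
    · refine ih₂ fun e he => ?_
      obtain ⟨w, hw, hwv⟩ := h e (Finset.mem_union_right _ he)
      exact ⟨w, hw.2, hwv⟩
  | ex y φ ih => exact ih h

/-- A tuple in the relation of an atom determines the values of all variables of that atom, so there
are at most as many restrictions as tuples. -/
theorem exists_card_le_of_mem_atomVars (d₀ : S.Dom) (φ : Formula σ) {e : Finset ℕ}
    (he : e ∈ φ.atomVars) :
    ∃ K : Finset (ℕ → S.Dom), K.card ≤ S.size ∧
      ∀ w, φ.MatrixSat S w → restrictTo d₀ e w ∈ K := by
  classical
  induction φ with
  | atom r t =>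
    obtain rfl : e = _ := Finset.mem_singleton.1 he
    refine ⟨(S.rel r).image fun τ =>
      if h : ∃ w : ℕ → S.Dom, (fun i => (t i).eval S w) = τ then
        restrictTo d₀ (Finset.univ.biUnion fun i => (t i).vars) h.choose
      else fun _ => d₀, ?_, fun w hw => ?_⟩
    · refine Finset.card_image_le.trans ?_
      have : (S.rel r).card ≤ ∑ r : σ.Rel, (S.rel r).card :=
        Finset.single_le_sum (f := fun r => (S.rel r).card) (fun _ _ => Nat.zero_le _)
          (Finset.mem_univ r)
      unfold FinStructure.size
      omega
    · refine Finset.mem_image.2 ⟨_, hw, ?_⟩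
      have hex : ∃ w' : ℕ → S.Dom, (fun i => (t i).eval S w') = fun i => (t i).eval S w :=
        ⟨w, rfl⟩
      rw [dif_pos hex]
      refine restrictTo_congr d₀ fun x hx => ?_
      obtain ⟨i, -, hi⟩ := Finset.mem_biUnion.1 hx
      exact Arg.eqOn_of_eval_eq (t i) (congrFun hex.choose_spec i) x hi
  | and φ ψ ih₁ ih₂ =>
    rcases Finset.mem_union.1 he with h | h
    · obtain ⟨K, hK, hKw⟩ := ih₁ h
      exact ⟨K, hK, fun w hw => hKw w hw.1⟩
    · obtain ⟨K, hK, hKw⟩ := ih₂ h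
      exact ⟨K, hK, fun w hw => hKw w hw.2⟩
  | ex y φ ih => exact ih he

/-- The values on `B` are determined by those on the covering edges, and each of these allows at
most `S.size` possibilities. -/
theorem exists_card_le_of_cover (d₀ : S.Dom) (φ : Formula σ) (E : Finset (Finset ℕ))
    (hE : ∀ e ∈ E, e ∈ φ.atomVars) (B : Finset ℕ) (hB : ∀ x ∈ B, ∃ e ∈ E, x ∈ e) :
    ∃ K : Finset (ℕ → S.Dom), K.card ≤ S.size ^ E.card ∧
      ∀ w, φ.MatrixSat S w → restrictTo d₀ B w ∈ K := by
  classical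
  induction E using Finset.induction_on generalizing B with
  | empty =>
    refine ⟨{fun _ => d₀}, by simp, fun w _ => Finset.mem_singleton.2 ?_⟩
    funext x
    exact restrictTo_of_notMem d₀ fun hx => by simpa using hB x hx
  | insert e E he ih =>
    obtain ⟨K₁, hK₁, hw₁⟩ := exists_card_le_of_mem_atomVars S d₀ φ
      (hE e (Finset.mem_insert_self _ _))
    obtain ⟨K₂, hK₂, hw₂⟩ := ih (fun f hf => hE f (Finset.mem_insert_of_mem hf)) (B \ e) (by
      intro x hx
      obtain ⟨hxB, hxe⟩ := Finset.mem_sdiff.1 hx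
      obtain ⟨f, hf, hxf⟩ := hB x hxB
      rcases Finset.mem_insert.1 hf with rfl | hf
      · exact absurd hxf hxe
      · exact ⟨f, hf, hxf⟩)
    refine ⟨Finset.image₂ (fun p q x => if x ∈ B ∩ e then p x else q x) K₁ K₂, ?_, fun w hw => ?_⟩
    · refine (Finset.card_image₂_le _ _ _).trans ?_
      rw [Finset.card_insert_of_notMem he, pow_succ, mul_comm]
      exact Nat.mul_le_mul hK₂ hK₁
    · refine Finset.mem_image₂.2 ⟨_, hw₁ w hw, _, hw₂ w hw, ?_⟩
      funext x
      by_cases hx : x ∈ B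
      · by_cases hxe : x ∈ e
        · simp [restrictTo, hx, hxe]
        · simp [restrictTo, hx, hxe]
      · simp [restrictTo, hx]

end Formula

theorem isSolution_iff (Φ : ConjQuery) (a : Φ.formula.free → Φ.str.Dom) :
    Φ.IsSolution a ↔
      ∃ w, Φ.formula.MatrixSat Φ.str w ∧ ∀ x : Φ.formula.free, w x = a x := by
  constructor
  · rintro ⟨v, hv, hs⟩
    obtain ⟨w, hw, hs⟩ := (Formula.sat_iff_exists_matrixSat _ Φ.clean v).1 hs
    refine ⟨w, hs, fun x => ?_⟩
    rw [hw x (Finset.disjoint_left.1 Φ.clean.disjoint_free_bound x.2), hv x]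
  · rintro ⟨w, hs, hw⟩
    exact ⟨w, hw, (Formula.sat_iff_exists_matrixSat _ Φ.clean w).2 ⟨w, fun _ _ => rfl, hs⟩⟩

end ConjQuery

/-! ### `S`-components and the tree decomposition of `S` by their bags -/

namespace Hypergraph

variable {α : Type*} {H : Hypergraph α} {S : Set α}

/-- Two edges share a vertex outside `S`. -/
def Linked (H : Hypergraph α) (S e f : Set α) : Prop :=
  e ∈ H.edgeSet ∧ f ∈ H.edgeSet ∧ ∃ x, x ∈ e ∧ x ∈ f ∧ x ∉ S

theorem Linked.symm {e f : Set α} (h : H.Linked S e f) : H.Linked S f e := by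
  obtain ⟨he, hf, x, hxe, hxf, hx⟩ := h
  exact ⟨hf, he, x, hxf, hxe, hx⟩

theorem reflTransGen_linked_symm {e f : Set α} (h : Relation.ReflTransGen (H.Linked S) e f) :
    Relation.ReflTransGen (H.Linked S) f e := by
  induction h with
  | refl => exact .refl
  | tail _ hbc ih => exact .head hbc.symm ih

/-- Two traces on `V \ S` intersect exactly when the edges share a vertex outside `S`. Chains of
such edges are easier to handle than paths in the induced hypergraph. -/
theorem mem_componentEdges_iff {e e' : Set α} (he : e ∈ H.edgeSet) (heS : ¬ e ⊆ S) :
    e' ∈ H.componentEdges S e ↔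
      e' ∈ H.edgeSet ∧ ¬ e' ⊆ S ∧ Relation.ReflTransGen (H.Linked S) e e' := by
  constructor
  · rintro ⟨he', heS', x, hx, y, hy, f, hf, g, hg, hxf, hyg, hfg⟩
    refine ⟨he', heS', ?_⟩
    obtain ⟨-, f₁, hf₁, rfl⟩ := hf
    have key : ∃ g₁ ∈ H.edgeSet, g = g₁ ∩ (H.vertexSet \ S) ∧
        Relation.ReflTransGen (H.Linked S) f₁ g₁ := by
      clear hyg hg
      induction hfg with
      | refl => exact ⟨f₁, hf₁, rfl, .refl⟩
      | tail _ hbc ih =>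
        obtain ⟨b₁, hb₁, rfl, hr⟩ := ih
        obtain ⟨-, ⟨-, c₁, hc₁, rfl⟩, z, hzb, hzc⟩ := hbc
        exact ⟨c₁, hc₁, rfl, hr.tail ⟨hb₁, hc₁, z, hzb.1, hzc.1, hzb.2.2⟩⟩
    obtain ⟨g₁, hg₁, rfl, hr⟩ := key
    exact (Relation.ReflTransGen.head ⟨he, hf₁, x, hx.1, hxf.1, hx.2⟩ hr).tail
      ⟨hg₁, he', y, hyg.1, hy.1, hy.2⟩
  · rintro ⟨he', heS', hr⟩
    have hmem : ∀ f ∈ H.edgeSet, ∀ x ∈ f, x ∉ S → f ∩ (H.vertexSet \ S) ∈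
        (H.inducedOn (H.vertexSet \ S)).edgeSet ∧ x ∈ f ∩ (H.vertexSet \ S) := by
      intro f hf x hxf hxS
      have : x ∈ f ∩ (H.vertexSet \ S) :=
        ⟨hxf, H.subset_vertexSet_of_mem_edgeSet' hf hxf, hxS⟩
      exact ⟨⟨⟨x, this⟩, f, hf, rfl⟩, this⟩
    obtain ⟨x, hxe, hxS⟩ := Set.not_subset.1 heS
    obtain ⟨y, hye, hyS⟩ := Set.not_subset.1 heS'
    refine ⟨he', heS', x, ⟨hxe, hxS⟩, y, ⟨hye, hyS⟩, _, (hmem e he x hxe hxS).1, _,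
      (hmem e' he' y hye hyS).1, (hmem e he x hxe hxS).2, (hmem e' he' y hye hyS).2, ?_⟩
    clear hye he' heS'
    induction hr with
    | refl => exact .refl
    | tail _ hbc ih =>
      obtain ⟨hb, hc, z, hzb, hzc, hzS⟩ := hbc
      exact ih.tail ⟨(hmem _ hb z hzb hzS).1, (hmem _ hc z hzc hzS).1, z,
        (hmem _ hb z hzb hzS).2, (hmem _ hc z hzc hzS).2⟩

theorem self_mem_componentEdges {e : Set α} (he : e ∈ H.edgeSet) (heS : ¬ e ⊆ S) :
    e ∈ H.componentEdges S e :=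
  (mem_componentEdges_iff he heS).2 ⟨he, heS, .refl⟩

theorem componentEdges_eq_of_reflTransGen {e f : Set α} (he : e ∈ H.edgeSet) (heS : ¬ e ⊆ S)
    (hf : f ∈ H.edgeSet) (hfS : ¬ f ⊆ S) (h : Relation.ReflTransGen (H.Linked S) e f) :
    H.componentEdges S e = H.componentEdges S f := by
  ext g
  rw [mem_componentEdges_iff he heS, mem_componentEdges_iff hf hfS]
  exact and_congr_right fun _ => and_congr_right fun _ =>
    ⟨fun hg => (reflTransGen_linked_symm h).trans hg, fun hg => h.trans hg⟩

theorem Linked.componentEdges_eq {e f : Set α} (h : H.Linked S e f) :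
    H.componentEdges S e = H.componentEdges S f := by
  obtain ⟨he, hf, x, hxe, hxf, hxS⟩ := h
  exact componentEdges_eq_of_reflTransGen he (fun h => hxS (h hxe)) hf (fun h => hxS (h hxf))
    (.single ⟨he, hf, x, hxe, hxf, hxS⟩)

open scoped Classical in
/-- The edge `e` itself if `e ⊆ S`, and otherwise the elements of `S` in the `S`-component
of `e`. -/
noncomputable def componentBag (H : Hypergraph α) (S e : Set α) : Set α :=
  if e ⊆ S then e else ⋃₀ H.componentEdges S e ∩ S

theorem componentBag_subset (e : Set α) : H.componentBag S e ⊆ S := by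
  unfold componentBag
  split_ifs with h
  · exact h
  · exact Set.inter_subset_right

theorem inter_subset_componentBag {e : Set α} (he : e ∈ H.edgeSet) :
    e ∩ S ⊆ H.componentBag S e := by
  unfold componentBag
  split_ifs with h
  · exact Set.inter_subset_left
  · exact fun x hx => ⟨⟨e, self_mem_componentEdges he h, hx.1⟩, hx.2⟩

theorem Linked.componentBag_eq {e f : Set α} (h : H.Linked S e f) :
    H.componentBag S e = H.componentBag S f := by
  have hc := h.componentEdges_eq
  obtain ⟨he, hf, x, hxe, hxf, hxS⟩ := h
  unfold componentBag
  rw [if_neg fun h => hxS (h hxe), if_neg fun h => hxS (h hxf), hc]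

/-- Replacing the labels of a join tree by the bags of the components gives a tree
decomposition. -/
theorem IsJoinTree.preconnected_componentBag {ι : Type*} {T : SimpleGraph ι} {lam : ι → Set α}
    (h : H.IsJoinTree T lam) (v : α) :
    (T.induce {t | v ∈ H.componentBag S (lam t)}).Preconnected := by
  set B : Set ι := {t | v ∈ H.componentBag S (lam t)} with hB
  -- If all nodes labelled by edges through `x` belong to `B`, the join tree connects them inside
  -- `B`.
  have hreach : ∀ x ∈ H.vertexSet, {t | x ∈ lam t} ⊆ B → ∀ s t (hs : s ∈ B) (ht : t ∈ B),
      x ∈ lam s → x ∈ lam t → (T.induce B).Reachable ⟨s, hs⟩ ⟨t, ht⟩ := by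
    intro x hx hsub s t hs ht hxs hxt
    exact (h.connected x hx ⟨s, hxs⟩ ⟨t, hxt⟩).map (T.induceHomOfLE hsub).toHom
  have hlink : ∀ s t (hs : s ∈ B) (ht : t ∈ B), H.Linked S (lam s) (lam t) →
      (T.induce B).Reachable ⟨s, hs⟩ ⟨t, ht⟩ := by
    intro s t hs ht hst
    obtain ⟨he, hf, x, hxs, hxt, hxS⟩ := id hst
    refine hreach x (H.subset_vertexSet_of_mem_edgeSet' he hxs) ?_ s t hs ht hxs hxt
    intro u hu
    have hl : H.Linked S (lam s) (lam u) := ⟨he, h.label_mem u, x, hxs, hu, hxS⟩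
    change v ∈ H.componentBag S (lam u)
    rw [← hl.componentBag_eq]
    exact hs
  -- Linked edges have the same bag. So all nodes whose label contains the linking vertex are in
  -- `B`, and the chain can be followed inside `B`.
  have hchain : ∀ s (hs : s ∈ B), ¬ lam s ⊆ S → ∀ f,
      Relation.ReflTransGen (H.Linked S) (lam s) f → ∀ t, lam t = f →
        ∃ ht : t ∈ B, (T.induce B).Reachable ⟨s, hs⟩ ⟨t, ht⟩ := by
    intro s hs hsS f hr
    induction hr with
    | refl =>
      intro t ht
      have htB : t ∈ B := by rw [hB, Set.mem_ofPred_eq, ht]; exact hs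
      obtain ⟨x, hxs, hxS⟩ := Set.not_subset.1 hsS
      exact ⟨htB, hlink s t hs htB ⟨h.label_mem s, h.label_mem t, x, hxs, ht ▸ hxs, hxS⟩⟩
    | @tail b c _ hbc ih =>
      rintro t rfl
      obtain ⟨u, rfl⟩ := h.label_surj b hbc.1
      obtain ⟨huB, hsu⟩ := ih u rfl
      have htB : t ∈ B := by
        rw [hB, Set.mem_ofPred_eq, ← hbc.componentBag_eq]
        exact huB
      exact ⟨htB, hsu.trans (hlink u t huB htB hbc)⟩
  -- Each node of `B` reaches, inside `B`, a node whose own label contains `v`. Those nodes are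
  -- connected with each other by the join tree property for `v`.
  have hnear : ∀ s (hs : s ∈ B), ∃ t, ∃ ht : t ∈ B, v ∈ lam t ∧
      (T.induce B).Reachable ⟨s, hs⟩ ⟨t, ht⟩ := by
    intro s hs
    by_cases hsS : lam s ⊆ S
    · refine ⟨s, hs, ?_, SimpleGraph.Reachable.refl _⟩
      have : v ∈ H.componentBag S (lam s) := hs
      rwa [componentBag, if_pos hsS] at this
    · have hv : v ∈ H.componentBag S (lam s) := hs
      rw [componentBag, if_neg hsS] at hv
      obtain ⟨⟨f, hf, hvf⟩, -⟩ := hv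
      obtain ⟨hfE, -, hr⟩ := (mem_componentEdges_iff (h.label_mem s) hsS).1 hf
      obtain ⟨t, rfl⟩ := h.label_surj f hfE
      obtain ⟨ht, hst⟩ := hchain s hs hsS _ hr t rfl
      exact ⟨t, ht, hvf, hst⟩
  rintro ⟨s, hs⟩ ⟨t, ht⟩
  obtain ⟨s', hs', hvs, hrs⟩ := hnear s hs
  obtain ⟨t', ht', hvt, hrt⟩ := hnear t ht
  have hvS : v ∈ S := componentBag_subset _ hs
  exact (hrs.trans (hreach v (H.subset_vertexSet_of_mem_edgeSet' (h.label_mem s') hvs)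
    (fun u hu => inter_subset_componentBag (h.label_mem u) ⟨hu, hvS⟩) s' t' hs' ht' hvs hvt)).trans
    hrt.symm

theorem IsJoinTree.preconnected_label {ι : Type*} {T : SimpleGraph ι} {lam : ι → Set α}
    (h : H.IsJoinTree T lam) (v : α) : (T.induce {t | v ∈ lam t}).Preconnected := by
  rintro ⟨s, hs⟩ ⟨t, ht⟩
  exact h.connected v (H.subset_vertexSet_of_mem_edgeSet' (h.label_mem s) hs) ⟨s, hs⟩ ⟨t, ht⟩

theorem HasStar.le_starSize {V : Finset α} (hV : H.vertexSet ⊆ V) {k : ℕ} (h : H.HasStar S k) :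
    k ≤ H.starSize S := by
  refine le_csSup ⟨V.card, ?_⟩ h
  rintro m ⟨e, he, heS, Y, rfl, hY, -⟩
  refine Finset.card_le_card fun y hy => ?_
  obtain ⟨⟨f, hf, hyf⟩, -⟩ := hY hy
  exact_mod_cast hV (H.subset_vertexSet_of_mem_edgeSet' hf.1 hyf)

end Hypergraph

/-! ### Acyclic queries of bounded quantified star size are in VP -/

namespace ConjQuery

open Formula

/-- An assignment is a solution as soon as it locally extends to one on each bag. -/
theorem Formula.exists_matrixSat_of_bags {σ : Signature} (S : FinStructure σ) (φ : Formula σ)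
    (a : ℕ → S.Dom)
    (h : ∀ e ∈ φ.atomVars, ∃ w, φ.MatrixSat S w ∧
      ∀ x ∈ φ.hypergraph.componentBag φ.free e, w x = a x) :
    ∃ w, φ.MatrixSat S w ∧ ∀ x ∈ φ.free, w x = a x := by
  classical
  set H := φ.hypergraph with hH
  have hedge : ∀ e ∈ φ.atomVars, (e : Set ℕ) ∈ H.edgeSet := fun e he => ⟨e, he, rfl⟩
  -- One witness is chosen for each component, not for each edge. All edges through a variable
  -- outside `S` lie in one component, so the value of that variable does not depend on the edge
  -- used to find it.
  let W : Set (Set ℕ) → ℕ → S.Dom := fun C =>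
    if hC : ∃ w, φ.MatrixSat S w ∧ ∀ x ∈ ⋃₀ C ∩ φ.free, w x = a x then hC.choose else a
  let w : ℕ → S.Dom := fun x => if x ∈ φ.free then a x else
    if hx : ∃ e ∈ φ.atomVars, x ∈ e then
      W (H.componentEdges φ.free (hx.choose : Set ℕ)) x else a x
  have hw : ∀ x ∈ φ.free, w x = a x := fun x hx => if_pos hx
  refine ⟨w, φ.matrixSat_of_forall_atomVars S w fun e he => ?_, hw⟩
  obtain ⟨w', hw', hwa⟩ := h e he
  by_cases heS : (e : Set ℕ) ⊆ φ.free
  · refine ⟨w', hw', fun x hx => ?_⟩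
    rw [hwa x (Hypergraph.inter_subset_componentBag (hedge e he) ⟨hx, heS hx⟩), hw x (heS hx)]
  · have hC : ∃ w, φ.MatrixSat S w ∧
        ∀ x ∈ ⋃₀ H.componentEdges φ.free (e : Set ℕ) ∩ φ.free, w x = a x := by
      refine ⟨w', hw', fun x hx => hwa x ?_⟩
      rwa [Hypergraph.componentBag, if_neg heS]
    have hWC : W (H.componentEdges φ.free (e : Set ℕ)) = hC.choose := dif_pos hC
    refine ⟨hC.choose, hC.choose_spec.1, fun x hx => ?_⟩
    by_cases hxS : x ∈ φ.free
    · rw [hw x hxS]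
      exact hC.choose_spec.2 x ⟨⟨e, Hypergraph.self_mem_componentEdges (hedge e he) heS, hx⟩, hxS⟩
    · have hex : ∃ e ∈ φ.atomVars, x ∈ e := ⟨e, he, hx⟩
      have hl : H.Linked φ.free (hex.choose : Set ℕ) e :=
        ⟨hedge _ hex.choose_spec.1, hedge e he, x, hex.choose_spec.2, hx, hxS⟩
      change _ = if x ∈ φ.free then a x else _
      rw [if_neg hxS, dif_pos hex, hl.componentEdges_eq, hWC]

/-- In an acyclic query every bag is covered by few edges. -/
theorem Formula.exists_cover_componentBag {σ : Signature} {φ : Formula σ}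
    (hφ : φ.hypergraph.IsAcyclic) {e : Finset ℕ} (he : e ∈ φ.atomVars) {B : Finset ℕ}
    (hB : (B : Set ℕ) = φ.hypergraph.componentBag φ.free e) :
    ∃ E : Finset (Finset ℕ), (∀ f ∈ E, f ∈ φ.atomVars) ∧ E.card ≤ φ.quantifiedStarSize + 1 ∧
      ∀ x ∈ B, ∃ f ∈ E, x ∈ f := by
  classical
  by_cases heS : (e : Set ℕ) ⊆ φ.free
  -- An edge inside `S` covers its own bag. This is the source of the `+ 1`, as the star size may be
  -- `0`.
  · refine ⟨{e}, by simpa using he, by simp, fun x hx => ⟨e, Finset.mem_singleton_self e, ?_⟩⟩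
    rw [Hypergraph.componentBag, if_pos heS] at hB
    exact_mod_cast hB ▸ (show x ∈ (B : Set ℕ) from hx)
  · rw [Hypergraph.componentBag, if_neg heS] at hB
    obtain ⟨m, T, lam, hT⟩ := hφ
    choose lamF hlamF hlam using hT.label_mem
    obtain ⟨l, hl, hmem⟩ := SimpleGraph.IsTree.exists_runningIntersection (α := ℕ) m
      (Fintype.card_fin m) hT.isTree lamF (fun v => by
        have hset : {t | v ∈ lamF t} = {t | v ∈ lam t} := Set.ext fun t => by
          change v ∈ lamF t ↔ v ∈ lam t
          rw [hlam, Finset.mem_coe]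
        rw [hset]
        exact hT.preconnected_label v)
    have hl' : ∀ f, f ∈ l ↔ f ∈ φ.atomVars := by
      intro f
      rw [hmem]
      constructor
      · rintro ⟨t, rfl⟩
        exact hlamF t
      · intro hf
        obtain ⟨t, ht⟩ := hT.label_surj f ⟨f, hf, rfl⟩
        exact ⟨t, by rw [hlam] at ht; exact_mod_cast ht⟩
    obtain ⟨Y, hY, K, hK, hcard, hcov, hind⟩ := hl.exists_independent_cover B (by
      intro x hx
      have hx' : x ∈ (B : Set ℕ) := hx
      rw [hB] at hx'
      obtain ⟨⟨f, ⟨⟨f, hf, rfl⟩, -⟩, hxf⟩, -⟩ := hx'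
      exact subset_listUnion ((hl' f).2 hf) hxf)
    refine ⟨K, fun f hf => (hl' f).1 (hK f hf), ?_, hcov⟩
    -- The independent set lies in the free part of one component, so it is a star, and the cover is
    -- no larger than it.
    have hstar : φ.hypergraph.HasStar φ.free Y.card := by
      refine ⟨e, ⟨e, he, rfl⟩, heS, Y, rfl, ?_, ?_⟩
      · rw [← hB]
        exact_mod_cast hY
      · rintro f ⟨f, hf, rfl⟩ x ⟨hxY, hxf⟩ y ⟨hyY, hyf⟩
        exact hind f ((hl' f).2 hf) x hxY y hyY hxf hyf
    have hle : Y.card ≤ φ.quantifiedStarSize := hstar.le_starSize (V := φ.vars) subset_rfl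
    omega

theorem Q_eq_sum_assignments (F : Type*) [Field F] (Φ : ConjQuery) (d₀ : Φ.str.Dom)
    (P : (ℕ → Φ.str.Dom) → Prop) [DecidablePred P]
    (hP : ∀ a : ℕ → Φ.str.Dom, P a ↔ Φ.IsSolution fun x => a x) :
    Φ.Q F = ∑ a ∈ assignments d₀ Φ.formula.free,
      (∏ x ∈ Φ.formula.free, MvPolynomial.X (a x)) * if P a then 1 else 0 := by
  classical
  rw [Q, Finset.sum_filter, assignments, Finset.sum_map]
  refine Finset.sum_congr rfl fun b _ => ?_
  simp only [Function.Embedding.coeFn_mk, hP, mul_ite, mul_one, mul_zero]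
  have hb : (fun x : Φ.formula.free => if h : (x : ℕ) ∈ Φ.formula.free then b ⟨x, h⟩ else d₀) =
      b := by
    funext x
    simp
  rw [hb, ← Finset.prod_coe_sort Φ.formula.free fun x =>
    (MvPolynomial.X (if h : x ∈ Φ.formula.free then b ⟨x, h⟩ else d₀) : MvPolynomial _ F)]
  simp

theorem totalDegree_Q_le (F : Type*) [Field F] (Φ : ConjQuery) :
    (Φ.Q F).totalDegree ≤ Φ.size := by
  refine MvPolynomial.totalDegree_finsetSum_le fun a _ => ?_
  refine (MvPolynomial.totalDegree_finsetProd _ _).trans ?_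
  simp only [MvPolynomial.totalDegree_X, Finset.sum_const, smul_eq_mul, mul_one, Finset.card_univ,
    Fintype.card_coe]
  refine (Finset.card_le_card Φ.formula.free_subset_vars).trans
    (Φ.formula.card_vars_le_size.trans ?_)
  exact Nat.le_add_right _ _

/-- The weight of a bag is the indicator that a partial assignment extends to a model of all atoms.
Deciding this may be hard, but its values are constants of the circuit. The exponent `k + 1` is the
number of atoms that cover a bag, and `Φ.size + 1` bounds the number of bags after pruning. -/
theorem exists_circuit_Q (F : Type*) [Field F] (Φ : ConjQuery) (hΦ : Φ.IsACQ) (k : ℕ)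
    (hk : Φ.formula.quantifiedStarSize ≤ k) :
    ∃ C : ArithCircuit F Φ.str.Dom, C.poly = Φ.Q F ∧
      C.size ≤ 2 + (Φ.size + 1) * ((Φ.size ^ (k + 1) + 1) *
        (Φ.size ^ (k + 1) * (2 * Φ.size + 3) + 2)) + 1 := by
  classical
  obtain ⟨d₀⟩ := Φ.str.nonemptyDom
  set φ := Φ.formula with hφ
  set M := Φ.size ^ (k + 1) with hM
  have hcard : φ.free.card ≤ Φ.size :=
    (Finset.card_le_card φ.free_subset_vars).trans
      (φ.card_vars_le_size.trans (Nat.le_add_right _ _))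
  have hpos : 0 < Φ.str.size := by
    have : 0 < Fintype.card Φ.str.Dom := Fintype.card_pos
    unfold FinStructure.size
    omega
  have hsize : Φ.str.size ≤ Φ.size := Nat.le_add_left _ _
  obtain ⟨m, T, lam, hT⟩ := id hΦ
  set bag : Fin m → Finset ℕ := fun t =>
    φ.free.filter fun x => x ∈ φ.hypergraph.componentBag φ.free (lam t) with hbag
  have hbag' : ∀ t, (bag t : Set ℕ) = φ.hypergraph.componentBag φ.free (lam t) := by
    intro t
    ext x
    simp only [hbag, Finset.coe_filter, Set.mem_ofPred_eq]
    exact ⟨fun h => h.2, fun h => ⟨Hypergraph.componentBag_subset _ h, h⟩⟩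
  have hmembag : ∀ v t, v ∈ bag t ↔ v ∈ φ.hypergraph.componentBag φ.free (lam t) := by
    intro v t
    rw [← hbag' t, Finset.mem_coe]
  obtain ⟨l, hl, hmem⟩ := SimpleGraph.IsTree.exists_runningIntersection (α := ℕ) m
    (Fintype.card_fin m) hT.isTree bag (fun v => by
      have hset : {t | v ∈ bag t} = {t | v ∈ φ.hypergraph.componentBag φ.free (lam t)} :=
        Set.ext fun t => hmembag v t
      rw [hset]
      exact hT.preconnected_componentBag v)
  obtain ⟨l', hl', hsub, hdom, hlen⟩ := hl.exists_prune
  have hbags : ∀ B ∈ l', ∃ e ∈ φ.atomVars, (B : Set ℕ) = φ.hypergraph.componentBag φ.free e := by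
    intro B hB
    obtain ⟨t, rfl⟩ := (hmem B).1 (hsub hB)
    obtain ⟨e, he, hte⟩ := hT.label_mem t
    exact ⟨e, he, by rw [hbag', hte]⟩
  have hbags' : ∀ e ∈ φ.atomVars, ∃ B ∈ l', φ.hypergraph.componentBag φ.free e ⊆ B := by
    intro e he
    obtain ⟨t, ht⟩ := hT.label_surj e ⟨e, he, rfl⟩
    obtain ⟨B, hB, htB⟩ := hdom (bag t) ((hmem _).2 ⟨t, rfl⟩)
    refine ⟨B, hB, ?_⟩
    rw [← ht, ← hbag']
    exact_mod_cast htB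
  have hBfree : ∀ B ∈ l', B ⊆ φ.free := by
    intro B hB x hx
    obtain ⟨e, he, hBe⟩ := hbags B hB
    have : x ∈ (B : Set ℕ) := hx
    rw [hBe] at this
    exact Hypergraph.componentBag_subset _ this
  have hunion : listUnion l' = φ.free := by
    ext x
    rw [mem_listUnion]
    constructor
    · rintro ⟨B, hB, hx⟩
      exact hBfree B hB hx
    · intro hx
      obtain ⟨e, he, hxe⟩ := φ.exists_mem_atomVars_of_mem_free hx
      obtain ⟨B, hB, hsubB⟩ := hbags' e he
      have hE : (e : Set ℕ) ∈ φ.hypergraph.edgeSet := ⟨e, he, rfl⟩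
      exact ⟨B, hB, hsubB (Hypergraph.inter_subset_componentBag hE ⟨hxe, hx⟩)⟩
  let good : Finset ℕ → (ℕ → Φ.str.Dom) → Prop := fun B a =>
    ∃ w, φ.MatrixSat Φ.str w ∧ ∀ x ∈ B, w x = a x
  let ind : Finset ℕ → (ℕ → Φ.str.Dom) → MvPolynomial Φ.str.Dom F := fun B a =>
    if good B a then 1 else 0
  have hgood : ∀ B a b, (∀ x ∈ B, a x = b x) → (good B a → good B b) :=
    fun B a b hab ⟨w, hw, hwa⟩ => ⟨w, hw, fun x hx => (hwa x hx).trans (hab x hx)⟩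
  have hsol : ∀ a : ℕ → Φ.str.Dom, (∀ B ∈ l', good B a) ↔ Φ.IsSolution fun x => a x := by
    intro a
    rw [isSolution_iff]
    constructor
    · intro h
      have hloc : ∀ e ∈ φ.atomVars, ∃ w, φ.MatrixSat Φ.str w ∧
          ∀ x ∈ φ.hypergraph.componentBag φ.free e, w x = a x := by
        intro e he
        obtain ⟨B, hB, heB⟩ := hbags' e he
        obtain ⟨w, hw, hwa⟩ := h B hB
        exact ⟨w, hw, fun x hx => hwa x (heB hx)⟩
      obtain ⟨w, hw, hwa⟩ := φ.exists_matrixSat_of_bags Φ.str a hloc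
      exact ⟨w, hw, fun x => hwa x x.2⟩
    · rintro ⟨w, hw, hwa⟩ B hB
      exact ⟨w, hw, fun x hx => hwa ⟨x, hBfree B hB hx⟩⟩
  have hprod : ∀ (l : List (Finset ℕ)) (a : ℕ → Φ.str.Dom),
      (l.map fun B => ind B a).prod = if ∀ B ∈ l, good B a then 1 else 0 := by
    intro l a
    induction l with
    | nil => simp
    | cons B l ih =>
      rw [List.map_cons, List.prod_cons, ih]
      by_cases h₁ : good B a <;> simp [ind, h₁]
  -- All initial weights are `0` or `1`, so two gates provide them.
  have hL₀ : IsStraightLine [MvPolynomial.C 1, (MvPolynomial.C 0 : MvPolynomial Φ.str.Dom F)] :=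
    .const 1 (.const 0 .nil)
  obtain ⟨L, hL, hLlen, hLmem⟩ := exists_straightLine_treeSum d₀ Φ.size M l'.length
    (l'.map fun B => (B, ind B)) (by simp) (by
      rw [List.map_map]
      simpa [Function.comp_def] using hl') (by
      intro p hp
      obtain ⟨B, hB, rfl⟩ := List.mem_map.1 hp
      obtain ⟨e, he, hBe⟩ := hbags B hB
      refine ⟨fun a b hab => ?_, ?_, (Finset.card_le_card (hBfree B hB)).trans hcard⟩
      · simp only [ind]
        rw [show good B a ↔ good B b from
          ⟨hgood B a b hab, hgood B b a fun x hx => (hab x hx).symm⟩]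
      · obtain ⟨E, hE, hEcard, hcov⟩ := Formula.exists_cover_componentBag hΦ he hBe
        obtain ⟨K, hK, hKw⟩ := Formula.exists_card_le_of_cover Φ.str d₀ φ E hE B hcov
        refine ⟨K, hK.trans ?_, fun a ha => ?_⟩
        · refine (Nat.pow_le_pow_right hpos (hEcard.trans (Nat.add_le_add_right hk 1))).trans ?_
          exact Nat.pow_le_pow_left hsize _
        · obtain ⟨w, hw, hwa⟩ : good B a := by
            by_contra hcon
            exact ha (if_neg hcon)
          rw [← restrictTo_congr d₀ hwa]
          exact hKw w hw) _ hL₀ (by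
      intro p hp a
      obtain ⟨B, hB, rfl⟩ := List.mem_map.1 hp
      by_cases h : good B a <;> simp [ind, h])
  obtain ⟨C, hC, hCsize⟩ := hL.exists_circuit hLmem
  refine ⟨C, ?_, ?_⟩
  · rw [hC, Q_eq_sum_assignments F Φ d₀ _ hsol]
    have hfst : (l'.map fun B => (B, ind B)).map Prod.fst = l' := by
      rw [List.map_map]
      simp [Function.comp_def]
    rw [hfst, hunion]
    refine Finset.sum_congr rfl fun a _ => ?_
    rw [← hprod l' a, List.map_map]
    rfl
  · rw [hCsize]
    refine hLlen.trans ?_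
    have h₁ : l'.length ≤ Φ.size + 1 := by
      rw [hunion] at hlen
      omega
    have := Nat.mul_le_mul_right ((M + 1) * (M * (2 * Φ.size + 3) + 2)) h₁
    simp only [List.length_cons, List.length_nil]
    omega

theorem isVP_Q (F : Type*) [Field F] (Φ : ℕ → ConjQuery) (hΦ : ∀ n, (Φ n).IsACQ)
    (hsize : PolyBounded fun n => (Φ n).size)
    (hk : ∃ k : ℕ, ∀ n, (Φ n).formula.quantifiedStarSize ≤ k) :
    IsVP fun n => (Φ n).Q F := by
  obtain ⟨k, hk⟩ := hk
  choose C hC hCsize using fun n => exists_circuit_Q F (Φ n) (hΦ n) k (hk n)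
  refine ⟨hsize.mono fun n => totalDegree_Q_le F (Φ n), C, hC, PolyBounded.mono ?_ hCsize⟩
  have hM := hsize.pow (k + 1)
  exact ((PolyBounded.const 2).add ((hsize.add (.const 1)).mul ((hM.add (.const 1)).mul
    ((hM.mul (((PolyBounded.const 2).mul hsize).add (.const 3))).add (.const 2))))).add (.const 1)

end ConjQuery

/-! ### Trees are acyclic hypergraphs -/

namespace Hypergraph

variable {α : Type*} {H : Hypergraph α}

theorem IsJoinTree.isAcyclic {ι : Type*} [Finite ι] {T : SimpleGraph ι} {lam : ι → Set α}
    (h : H.IsJoinTree T lam) : H.IsAcyclic := by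
  obtain ⟨m, ⟨f⟩⟩ := Finite.exists_equiv_fin ι
  refine ⟨m, T.comap f.symm, fun t => lam (f.symm t), ?_, fun t => h.label_mem _, fun e he => ?_,
    fun v hv => ?_⟩
  · exact (SimpleGraph.Iso.comap f.symm T).isTree_iff.2 h.isTree
  · obtain ⟨t, ht⟩ := h.label_surj e he
    exact ⟨f t, by simpa using ht⟩
  · rintro ⟨s, hs⟩ ⟨t, ht⟩
    let φ : T.induce {t | v ∈ lam t} →g
        (T.comap f.symm).induce {t | v ∈ lam (f.symm t)} :=
      { toFun := fun u => ⟨f u, by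
          change v ∈ lam (f.symm (f u))
          rw [f.symm_apply_apply]
          exact u.2⟩
        map_rel' := by
          intro a b hab
          change T.Adj (f.symm (f a)) (f.symm (f b))
          rw [f.symm_apply_apply, f.symm_apply_apply]
          exact hab }
    have hr := (h.connected v hv ⟨f.symm s, hs⟩ ⟨f.symm t, ht⟩).map φ
    have hφ : ∀ u (hu : v ∈ lam (f.symm u)), φ ⟨f.symm u, hu⟩ = ⟨u, hu⟩ :=
      fun u hu => Subtype.ext (f.apply_symm_apply u)
    rwa [hφ, hφ] at hr

theorem eq_pair_of_ncard_two {e : Set α} (he : e.ncard = 2) {x y : α} (hx : x ∈ e) (hy : y ∈ e)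
    (hxy : x ≠ y) : e = {x, y} := by
  symm
  refine Set.eq_of_subset_of_ncard_le (Set.insert_subset hx (Set.singleton_subset_iff.2 hy)) ?_
    (Set.finite_of_ncard_ne_zero (by omega))
  rw [he, Set.ncard_pair hxy]

/-- The tree is its own join tree: label a vertex by the edge to its parent. The labels that contain
`x` belong to `x` and some of its neighbours, which form a star around `x`. -/
theorem IsTreeGraph.isAcyclic (h : H.IsTreeGraph) (hV : H.vertexSet.Finite)
    (hE : H.edgeSet.Nonempty) : H.IsAcyclic := by
  classical
  obtain ⟨hcard, hT⟩ := h
  have : Finite H.vertexSet := hV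
  have hmem : ∀ {e}, e ∈ H.edgeSet → ∀ {x}, x ∈ e → x ∈ H.vertexSet :=
    fun he _ hx => H.subset_vertexSet_of_mem_edgeSet' he hx
  have hadj : ∀ {x y : H.vertexSet}, H.primalGraph.Adj x y → ({(x : α), (y : α)} : Set α) ∈
      H.edgeSet := by
    rintro x y ⟨hxy, e, he, hx, hy⟩
    rw [← eq_pair_of_ncard_two (hcard e he) hx hy fun h => hxy (Subtype.ext h)]
    exact he
  have hedge : ∀ e ∈ H.edgeSet, ∃ x y : H.vertexSet, H.primalGraph.Adj x y ∧
      e = {(x : α), (y : α)} := by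
    intro e he
    obtain ⟨x, y, hxy, rfl⟩ := Set.ncard_eq_two.1 (hcard e he)
    exact ⟨⟨x, hmem he (by simp)⟩, ⟨y, hmem he (by simp)⟩,
      ⟨fun h => hxy (congrArg Subtype.val h), _, he, by simp, by simp⟩, rfl⟩
  obtain ⟨e₀, he₀⟩ := hE
  obtain ⟨r, c₀, hrc, -⟩ := hedge e₀ he₀
  choose P hP hPu using fun v => hT.existsUnique_path r v
  -- The root has no parent and repeats the edge to an arbitrary neighbour `c₀`; labels need not be
  -- distinct.
  let par : H.vertexSet → H.vertexSet := fun v => if v = r then c₀ else (P v).penultimate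
  have hpar : ∀ v, H.primalGraph.Adj v (par v) := by
    intro v
    by_cases hv : v = r
    · simp only [par, if_pos hv]
      exact hv ▸ hrc
    · simp only [par, if_neg hv]
      exact ((P v).adj_penultimate (SimpleGraph.Walk.not_nil_of_ne (Ne.symm hv))).symm
  have hparent : ∀ v w, H.primalGraph.Adj v w → w ∈ (P v).support → par v = w := by
    intro v w hvw hw
    have hv : v ≠ r := by
      rintro rfl
      have hnil : P v = SimpleGraph.Walk.nil := (hPu v _ SimpleGraph.Walk.IsPath.nil).symm
      rw [hnil] at hw
      simp only [SimpleGraph.Walk.support_nil, List.mem_singleton] at hw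
      exact hvw.ne hw.symm
    simp only [par, if_neg hv]
    exact (hT.isAcyclic.eq_penultimate_of_adj_end (hP v) hvw hw).symm
  have hjoin : H.IsJoinTree H.primalGraph fun v => {(v : α), (par v : α)} := by
    refine ⟨hT, fun v => hadj (hpar v), fun e he => ?_, fun x hx => ?_⟩
    · obtain ⟨v, w, hvw, rfl⟩ := hedge e he
      by_cases hv : v ∈ (P w).support
      · refine ⟨w, ?_⟩
        rw [hparent w v hvw.symm hv, Set.pair_comm]
      · refine ⟨v, ?_⟩
        rw [hparent v w hvw (hT.isAcyclic.mem_support_of_ne_mem_support_of_adj_of_isPath (hP v)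
          (hP w) hvw hv)]
    · have hnode : ∀ t : {t : H.vertexSet | x ∈ ({(t : α), (par t : α)} : Set α)},
          (H.primalGraph.induce {t : H.vertexSet | x ∈ ({(t : α), (par t : α)} : Set α)}).Reachable
            t ⟨⟨x, hx⟩, Set.mem_insert _ _⟩ := by
        rintro ⟨t, ht⟩
        rcases ht with ht | ht
        · obtain rfl : t = ⟨x, hx⟩ := Subtype.ext ht.symm
          exact SimpleGraph.Reachable.refl _
        · refine SimpleGraph.Adj.reachable ?_
          have hpt : par t = ⟨x, hx⟩ := Subtype.ext (Set.mem_singleton_iff.1 ht).symm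
          have := hpar t
          rw [hpt] at this
          exact this
      exact fun s t => (hnode s).trans (hnode t).symm
  exact hjoin.isAcyclic

end Hypergraph

namespace ConjQuery

theorem Formula.atomVars_nonempty {σ : Signature} (φ : Formula σ) : φ.atomVars.Nonempty := by
  induction φ with
  | atom r t => exact Finset.singleton_nonempty _
  | and φ ψ ih₁ _ => exact ih₁.mono Finset.subset_union_left
  | ex x φ ih => exact ih

theorem isACQ_of_isTreeGraph {Φ : ConjQuery} (h : Φ.formula.hypergraph.IsTreeGraph) :
    Φ.IsACQ := by
  obtain ⟨e, he⟩ := Φ.formula.atomVars_nonempty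
  exact h.isAcyclic Φ.formula.vars.finite_toSet ⟨e, e, he, rfl⟩

theorem Formula.IsQuantifierFree.quantifiedStarSize_eq_zero {σ : Signature} {φ : Formula σ}
    (h : φ.IsQuantifierFree) : φ.quantifiedStarSize = 0 := by
  have hset : {k | φ.hypergraph.HasStar φ.free k} = ∅ := by
    refine Set.eq_empty_of_forall_notMem ?_
    rintro k ⟨e, he, heS, -⟩
    refine heS ?_
    rw [h]
    exact φ.hypergraph.subset_vertexSet_of_mem_edgeSet' he
  rw [quantifiedStarSize, Hypergraph.starSize, hset, csSup_empty]
  rfl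

end ConjQuery

/-! ### Sums over labellings of trees -/

/-- A rooted tree built from one-vertex trees by attaching the root of one tree as a child to the
root of another. The vertices take labels in `Δ`; a vertex has a weight in `W` for every label, and
an edge carries a relation between the labels of its ends. -/
inductive TreeNet (Δ : Type) (W : Type*) where
  | leaf (w : Δ → W)
  | graft (t : TreeNet Δ W) (R : Δ → Δ → Prop) (s : TreeNet Δ W)

namespace TreeNet

variable {Δ : Type} {W : Type*}

/-- The vertices. -/
def Vert : TreeNet Δ W → Type
  | leaf _ => Unit
  | graft t _ s => t.Vert ⊕ s.Vert

/-- The edges. -/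
def Edge : TreeNet Δ W → Type
  | leaf _ => Empty
  | graft t _ s => Option (t.Edge ⊕ s.Edge)

/-- The root. -/
def root : (t : TreeNet Δ W) → t.Vert
  | leaf _ => ()
  | graft t _ _ => Sum.inl t.root

/-- The parent end of an edge. -/
def src : (t : TreeNet Δ W) → t.Edge → t.Vert
  | leaf _, e => Empty.elim e
  | graft t _ _, none => Sum.inl t.root
  | graft t _ _, some (Sum.inl e) => Sum.inl (t.src e)
  | graft _ _ s, some (Sum.inr e) => Sum.inr (s.src e)

/-- The child end of an edge. -/
def tgt : (t : TreeNet Δ W) → t.Edge → t.Vert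
  | leaf _, e => Empty.elim e
  | graft _ _ s, none => Sum.inr s.root
  | graft t _ _, some (Sum.inl e) => Sum.inl (t.tgt e)
  | graft _ _ s, some (Sum.inr e) => Sum.inr (s.tgt e)

/-- The relation on an edge. -/
def rel : (t : TreeNet Δ W) → t.Edge → Δ → Δ → Prop
  | leaf _, e => Empty.elim e
  | graft _ R _, none => R
  | graft t _ _, some (Sum.inl e) => t.rel e
  | graft _ _ s, some (Sum.inr e) => s.rel e

/-- The weights at a vertex. -/
def weight : (t : TreeNet Δ W) → t.Vert → Δ → W
  | leaf w, _ => w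
  | graft t _ _, Sum.inl v => t.weight v
  | graft _ _ s, Sum.inr v => s.weight v

/-- The number of vertices. -/
def size : TreeNet Δ W → ℕ
  | leaf _ => 1
  | graft t _ s => t.size + s.size

instance fintypeVert : (t : TreeNet Δ W) → Fintype t.Vert
  | leaf _ => inferInstanceAs (Fintype Unit)
  | graft t _ s =>
    letI := fintypeVert t
    letI := fintypeVert s
    inferInstanceAs (Fintype (t.Vert ⊕ s.Vert))

instance fintypeEdge : (t : TreeNet Δ W) → Fintype t.Edge
  | leaf _ => inferInstanceAs (Fintype Empty)
  | graft t _ s =>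
    letI := fintypeEdge t
    letI := fintypeEdge s
    inferInstanceAs (Fintype (Option (t.Edge ⊕ s.Edge)))

theorem card_vert (t : TreeNet Δ W) : Fintype.card t.Vert = t.size := by
  induction t with
  | leaf w => exact Fintype.card_unit
  | graft t R s ih₁ ih₂ =>
    refine Eq.trans (Fintype.card_sum (α := t.Vert) (β := s.Vert)) ?_
    rw [ih₁, ih₂, size]

theorem card_edge_add_one (t : TreeNet Δ W) : Fintype.card t.Edge + 1 = t.size := by
  induction t with
  | leaf w => exact congrArg (· + 1) Fintype.card_empty
  | graft t R s ih₁ ih₂ =>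
    have h : Fintype.card (graft t R s).Edge = Fintype.card t.Edge + Fintype.card s.Edge + 1 :=
      (Fintype.card_option (α := t.Edge ⊕ s.Edge)).trans (by rw [Fintype.card_sum])
    rw [h, size]
    omega

theorem src_ne_tgt (t : TreeNet Δ W) (e : t.Edge) : t.src e ≠ t.tgt e := by
  induction t with
  | leaf w => exact Empty.elim e
  | graft t R s ih₁ ih₂ =>
    match e with
    | none => exact Sum.inl_ne_inr
    | some (Sum.inl e) => exact fun h => ih₁ e (Sum.inl_injective h)
    | some (Sum.inr e) => exact fun h => ih₂ e (Sum.inr_injective h)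

theorem eq_root_or_exists_tgt (t : TreeNet Δ W) (v : t.Vert) :
    v = t.root ∨ ∃ e, t.tgt e = v := by
  induction t with
  | leaf w => exact Or.inl rfl
  | graft t R s ih₁ ih₂ =>
    match v with
    | Sum.inl v =>
      rcases ih₁ v with rfl | ⟨e, rfl⟩
      · exact Or.inl rfl
      · exact Or.inr ⟨some (Sum.inl e), rfl⟩
    | Sum.inr v =>
      rcases ih₂ v with rfl | ⟨e, rfl⟩
      · exact Or.inr ⟨none, rfl⟩
      · exact Or.inr ⟨some (Sum.inr e), rfl⟩

theorem exists_edge_of_graft (t : TreeNet Δ W) (R : Δ → Δ → Prop) (s : TreeNet Δ W)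
    (v : (graft t R s).Vert) : ∃ e, (graft t R s).src e = v ∨ (graft t R s).tgt e = v := by
  rcases eq_root_or_exists_tgt _ v with rfl | ⟨e, he⟩
  · exact ⟨none, Or.inl rfl⟩
  · exact ⟨e, Or.inr he⟩

theorem reflTransGen_root (t : TreeNet Δ W) (v : t.Vert) :
    Relation.ReflTransGen (fun u w => ∃ e, t.src e = u ∧ t.tgt e = w) t.root v := by
  induction t with
  | leaf w => exact .refl
  | graft t R s ih₁ ih₂ =>
    match v with
    | Sum.inl v =>
      refine Relation.ReflTransGen.lift Sum.inl ?_ _ _ (ih₁ v)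
      rintro u w ⟨e, rfl, rfl⟩
      exact ⟨some (Sum.inl e), rfl, rfl⟩
    | Sum.inr v =>
      refine Relation.ReflTransGen.head (b := Sum.inr s.root) ⟨none, rfl, rfl⟩ ?_
      refine Relation.ReflTransGen.lift Sum.inr ?_ _ _ (ih₂ v)
      rintro u w ⟨e, rfl, rfl⟩
      exact ⟨some (Sum.inr e), rfl, rfl⟩

/-- The underlying graph. -/
def graph (t : TreeNet Δ W) : SimpleGraph t.Vert where
  Adj u v := ∃ e, (t.src e = u ∧ t.tgt e = v) ∨ (t.src e = v ∧ t.tgt e = u)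
  symm := ⟨fun _ _ ⟨e, h⟩ => ⟨e, h.symm⟩⟩
  loopless := ⟨fun _ ⟨e, h⟩ => t.src_ne_tgt e (h.elim (fun h => h.1.trans h.2.symm)
    fun h => h.1.trans h.2.symm)⟩

theorem isTree_graph (t : TreeNet Δ W) : t.graph.IsTree := by
  have hroot : ∀ v, t.graph.Reachable t.root v := by
    intro v
    rw [SimpleGraph.reachable_iff_reflTransGen]
    exact Relation.ReflTransGen.mono (fun _ _ ⟨e, h⟩ => ⟨e, Or.inl h⟩) _ _ (t.reflTransGen_root v)
  have hconn : t.graph.Connected :=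
    { preconnected := fun u v => (hroot u).symm.trans (hroot v)
      nonempty := ⟨t.root⟩ }
  -- A connected graph with at most one edge fewer than vertices is a tree; only the upper bound on
  -- the number of edges needs the construction.
  refine SimpleGraph.isTree_iff_connected_and_card.2 ⟨hconn, ?_⟩
  refine le_antisymm ?_ hconn.card_vert_le_card_edgeSet_add_one
  rw [Nat.card_eq_fintype_card (α := t.Vert), card_vert, ← card_edge_add_one]
  refine Nat.add_le_add_right ?_ 1
  have hsub : t.graph.edgeSet ⊆ Set.range fun e => s(t.src e, t.tgt e) := by
    intro z
    induction z using Sym2.ind with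
    | _ u v =>
      rintro ⟨e, ⟨rfl, rfl⟩ | ⟨rfl, rfl⟩⟩
      · exact ⟨e, rfl⟩
      · exact ⟨e, Sym2.eq_swap⟩
  calc Nat.card t.graph.edgeSet ≤ Nat.card (Set.range fun e => s(t.src e, t.tgt e)) :=
        Nat.card_mono (Set.finite_range _) hsub
    _ ≤ Nat.card t.Edge := Finite.card_range_le _
    _ = _ := Nat.card_eq_fintype_card

/-- A labelling of the vertices that satisfies the relations on the edges. -/
def Consistent (t : TreeNet Δ W) (a : t.Vert → Δ) : Prop :=
  ∀ e, t.rel e (a (t.src e)) (a (t.tgt e))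

theorem consistent_graft_iff (t : TreeNet Δ W) (R : Δ → Δ → Prop) (s : TreeNet Δ W)
    (a : t.Vert → Δ) (b : s.Vert → Δ) :
    (graft t R s).Consistent (Sum.elim a b) ↔
      t.Consistent a ∧ R (a t.root) (b s.root) ∧ s.Consistent b := by
  constructor
  · exact fun h => ⟨fun e => h (some (Sum.inl e)), h none, fun e => h (some (Sum.inr e))⟩
  · rintro ⟨h₁, h₂, h₃⟩ e
    match e with
    | none => exact h₂
    | some (Sum.inl e) => exact h₁ e
    | some (Sum.inr e) => exact h₃ e

variable [Fintype Δ] {A : Type*} [CommSemiring A] (ev : W → A)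

open scoped Classical in
/-- The sum of the weights of all consistent labellings with a given label at the root. -/
noncomputable def val : TreeNet Δ W → Δ → A
  | leaf w, d => ev (w d)
  | graft t R s, d => val t d * ∑ d', if R d d' then val s d' else 0

-- Distributivity: a labelling of a graft is a pair of labellings, and the two interact only through
-- the relation between the roots.
open scoped Classical in
theorem val_eq_sum (t : TreeNet Δ W) (d : Δ) :
    t.val ev d = ∑ a : t.Vert → Δ,
      if a t.root = d ∧ t.Consistent a then ∏ v, ev (t.weight v (a v)) else 0 := by
  induction t generalizing d with
  | leaf w =>
    rw [val, Finset.sum_eq_single fun _ => d]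
    · rw [if_pos ⟨rfl, fun e => Empty.elim e⟩]
      exact (Fintype.prod_unique (ι := Unit) fun _ => ev (w d)).symm
    · intro a _ ha
      refine if_neg fun h => ha ?_
      funext v
      exact h.1
    · simp
  | graft t R s ih₁ ih₂ =>
    have hs : (∑ d', if R d d' then s.val ev d' else 0) =
        ∑ b : s.Vert → Δ, if R d (b s.root) ∧ s.Consistent b then
          ∏ v, ev (s.weight v (b v)) else 0 := by
      simp only [ih₂]
      have : ∀ d', (if R d d' then ∑ b : s.Vert → Δ, if b s.root = d' ∧ s.Consistent b then
            ∏ v, ev (s.weight v (b v)) else 0 else 0) =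
          ∑ b : s.Vert → Δ, if b s.root = d' then (if R d (b s.root) ∧ s.Consistent b then
            ∏ v, ev (s.weight v (b v)) else 0) else 0 := by
        intro d'
        by_cases h : R d d'
        · rw [if_pos h]
          refine Finset.sum_congr rfl fun b _ => ?_
          by_cases hb : b s.root = d'
          · subst hb
            simp [h]
          · simp [hb]
        · rw [if_neg h]
          refine (Finset.sum_eq_zero fun b _ => ?_).symm
          by_cases hb : b s.root = d'
          · subst hb
            simp [h]
          · simp [hb]
      simp only [this]
      rw [Finset.sum_comm]
      simp
    rw [val, hs, ih₁, Finset.sum_mul_sum, ← Fintype.sum_prod_type']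
    let split : (t.Vert → Δ) × (s.Vert → Δ) ≃ ((graft t R s).Vert → Δ) :=
      (Equiv.sumArrowEquivProdArrow t.Vert s.Vert Δ).symm
    have hsum : ∀ f : (t.Vert ⊕ s.Vert → Δ) → A, ∑ c : (graft t R s).Vert → Δ, f c =
        ∑ p : (t.Vert → Δ) × (s.Vert → Δ), f (Sum.elim p.1 p.2) := fun f =>
      (Fintype.sum_equiv (e := split) (fun p => f (Sum.elim p.1 p.2)) (fun c => f c)
        fun _ => rfl).symm
    refine Eq.trans ?_ (hsum _).symm
    refine Finset.sum_congr rfl ?_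
    rintro ⟨a, b⟩ -
    have hprod : ∏ v, ev ((graft t R s).weight v (Sum.elim a b v)) =
        (∏ v, ev (t.weight v (a v))) * ∏ v, ev (s.weight v (b v)) :=
      Fintype.prod_sum_type (α₁ := t.Vert) (α₂ := s.Vert) fun v =>
        ev ((graft t R s).weight v (Sum.elim a b v))
    have hroot : Sum.elim a b (graft t R s).root = a t.root := rfl
    have hcons := consistent_graft_iff t R s a b
    simp only
    rw [hprod]
    by_cases h₁ : a t.root = d
    · subst h₁
      by_cases h₂ : t.Consistent a
      · by_cases h₃ : R (a t.root) (b s.root) ∧ s.Consistent b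
        · rw [if_pos ⟨rfl, h₂⟩, if_pos h₃, if_pos ⟨hroot, hcons.2 ⟨h₂, h₃⟩⟩]
        · rw [if_neg h₃, mul_zero, if_neg fun h => h₃ (hcons.1 h.2).2]
      · rw [if_neg fun h => h₂ h.2, zero_mul, if_neg fun h => h₂ (hcons.1 h.2).1]
    · rw [if_neg fun h => h₁ h.1, zero_mul, if_neg fun h => h₁ h.1]

open scoped Classical in
theorem sum_val (t : TreeNet Δ W) :
    ∑ d, t.val ev d = ∑ a : t.Vert → Δ with t.Consistent a, ∏ v, ev (t.weight v (a v)) := by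
  simp only [val_eq_sum]
  rw [Finset.sum_comm, Finset.sum_filter]
  refine Finset.sum_congr rfl fun a _ => ?_
  simp only [ite_and]
  simp

end TreeNet

/-! ### The quantifier-free query of a tree -/

namespace TreeNet

open ConjQuery

variable {Δ : Type} {W : Type*} (t : TreeNet Δ W)

/-- One binary relation symbol for every edge. -/
abbrev signature : Signature where
  Rel := t.Edge
  arity _ := 2
  Con := Empty

open scoped Classical in
/-- The domain consists of the labelled vertices, and the relation of an edge of the pairs of
labels of its ends that satisfy the relation on the edge. -/
noncomputable abbrev structureOf [Fintype Δ] [Nonempty Δ] : FinStructure t.signature where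
  Dom := t.Vert × Δ
  finDom := inferInstance
  nonemptyDom := ⟨(t.root, Classical.arbitrary Δ)⟩
  rel e := Finset.univ.filter fun τ : Fin 2 → t.Vert × Δ =>
    (τ 0).1 = t.src e ∧ (τ 1).1 = t.tgt e ∧ t.rel e (τ 0).2 (τ 1).2
  con c := c.elim

/-- The variable of a vertex. -/
noncomputable def varOf (v : t.Vert) : ℕ := Fintype.equivFin t.Vert v

theorem varOf_injective : Function.Injective t.varOf :=
  fun _ _ h => (Fintype.equivFin t.Vert).injective (Fin.ext h)

/-- The atom of an edge. -/
noncomputable def edgeAtom (e : t.Edge) : Formula t.signature :=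
  .atom e ![.var (t.varOf (t.src e)), .var (t.varOf (t.tgt e))]

/-- The conjunction of the atoms of a nonempty list of edges. -/
noncomputable def edgeConj (e : t.Edge) : List t.Edge → Formula t.signature
  | [] => t.edgeAtom e
  | f :: l => .and (t.edgeAtom f) (edgeConj e l)

theorem edgeAtom_vars (e : t.Edge) :
    (t.edgeAtom e).vars = {t.varOf (t.src e), t.varOf (t.tgt e)} := by
  ext x
  simp [edgeAtom, Formula.vars, Fin.exists_fin_two, Arg.vars]

theorem edgeConj_bound (e : t.Edge) (l : List t.Edge) : (t.edgeConj e l).bound = ∅ := by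
  induction l with
  | nil => rfl
  | cons f l ih => simp [edgeConj, Formula.bound, edgeAtom, ih]

theorem edgeConj_clean (e : t.Edge) (l : List t.Edge) : (t.edgeConj e l).Clean := by
  induction l with
  | nil => trivial
  | cons f l ih =>
    refine ⟨trivial, ih, ?_, ?_⟩
    · simp [edgeAtom, Formula.bound]
    · rw [edgeConj_bound]
      exact Finset.disjoint_empty_right _

theorem edgeConj_isQuantifierFree (e : t.Edge) (l : List t.Edge) :
    (t.edgeConj e l).IsQuantifierFree := by
  induction l with
  | nil => rfl
  | cons f l ih =>
    have ih' : (t.edgeConj e l).free = (t.edgeConj e l).vars := ih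
    simp only [Formula.IsQuantifierFree, edgeConj, Formula.free, Formula.vars, ih']
    rfl

theorem mem_edgeConj_vars (e : t.Edge) (l : List t.Edge) (x : ℕ) :
    x ∈ (t.edgeConj e l).vars ↔
      ∃ f ∈ e :: l, x = t.varOf (t.src f) ∨ x = t.varOf (t.tgt f) := by
  induction l with
  | nil => simp [edgeConj, edgeAtom_vars]
  | cons f l ih =>
    simp only [edgeConj, Formula.vars, Finset.mem_union, ih, edgeAtom_vars, Finset.mem_insert,
      Finset.mem_singleton, List.mem_cons, exists_eq_or_imp]
    exact or_left_comm

theorem mem_edgeConj_atomVars (e : t.Edge) (l : List t.Edge) (s : Finset ℕ) :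
    s ∈ (t.edgeConj e l).atomVars ↔
      ∃ f ∈ e :: l, s = {t.varOf (t.src f), t.varOf (t.tgt f)} := by
  have h : ∀ f, (t.edgeAtom f).atomVars = {{t.varOf (t.src f), t.varOf (t.tgt f)}} := by
    intro f
    rw [← edgeAtom_vars]
    rfl
  induction l with
  | nil => simp [edgeConj, h]
  | cons f l ih =>
    simp only [edgeConj, Formula.atomVars, Finset.mem_union, ih, h, Finset.mem_singleton,
      List.mem_cons, exists_eq_or_imp]
    tauto

theorem edgeConj_size (e : t.Edge) (l : List t.Edge) :
    (t.edgeConj e l).size = 4 * l.length + 3 := by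
  induction l with
  | nil => rfl
  | cons f l ih =>
    have : (t.edgeAtom f).size = 3 := rfl
    simp only [edgeConj, Formula.size, ih, this, List.length_cons]
    ring

variable [Fintype Δ] [Nonempty Δ]

theorem edgeConj_matrixSat (e : t.Edge) (l : List t.Edge) (w : ℕ → t.Vert × Δ) :
    (t.edgeConj e l).MatrixSat t.structureOf w ↔ ∀ f ∈ e :: l,
      (w (t.varOf (t.src f))).1 = t.src f ∧ (w (t.varOf (t.tgt f))).1 = t.tgt f ∧
        t.rel f (w (t.varOf (t.src f))).2 (w (t.varOf (t.tgt f))).2 := by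
  have h : ∀ f, (t.edgeAtom f).MatrixSat t.structureOf w ↔
      (w (t.varOf (t.src f))).1 = t.src f ∧ (w (t.varOf (t.tgt f))).1 = t.tgt f ∧
        t.rel f (w (t.varOf (t.src f))).2 (w (t.varOf (t.tgt f))).2 := by
    intro f
    simp [edgeAtom, Formula.MatrixSat, Arg.eval]
  induction l with
  | nil => simp [edgeConj, h]
  | cons f l ih =>
    simp only [edgeConj, Formula.MatrixSat, ih, h, List.forall_mem_cons]
    tauto

/-- The conjunctive query of a tree with a distinguished edge. -/
noncomputable def query (e : t.Edge) : ConjQuery where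
  sig := t.signature
  str := t.structureOf
  formula := t.edgeConj e Finset.univ.toList
  clean := t.edgeConj_clean _ _

theorem query_size_le (e : t.Edge) :
    (t.query e).size ≤ 4 * t.size + t.size * Fintype.card Δ +
      t.size * (t.size * Fintype.card Δ) ^ 2 := by
  classical
  have h₁ : (t.query e).formula.size = 4 * Fintype.card t.Edge + 3 := by
    rw [query, edgeConj_size, Finset.length_toList, Finset.card_univ]
  have h₂ : (t.query e).str.size ≤ t.size * Fintype.card Δ +
      Fintype.card t.Edge * (t.size * Fintype.card Δ) ^ 2 := by
    change Fintype.card (t.Vert × Δ) + ∑ r : t.Edge, (t.structureOf.rel r).card ≤ _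
    rw [Fintype.card_prod, card_vert]
    refine Nat.add_le_add_left ?_ _
    rw [← smul_eq_mul, ← Finset.card_univ]
    refine Finset.sum_le_card_nsmul _ _ _ fun r _ => ?_
    refine (Finset.card_le_univ _).trans ?_
    rw [Fintype.card_fun, Fintype.card_prod, card_vert, Fintype.card_fin]
  have h₃ := t.card_edge_add_one
  have h₄ : Fintype.card t.Edge * (t.size * Fintype.card Δ) ^ 2 ≤
      t.size * (t.size * Fintype.card Δ) ^ 2 := Nat.mul_le_mul_right _ (by omega)
  unfold ConjQuery.size
  omega

variable {t}

theorem mem_query_free_iff {e : t.Edge} (he : ∀ v, ∃ f, t.src f = v ∨ t.tgt f = v) (x : ℕ) :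
    x ∈ (t.query e).formula.free ↔ ∃ v, t.varOf v = x := by
  have hqf : (t.query e).formula.free = (t.query e).formula.vars :=
    t.edgeConj_isQuantifierFree e _
  rw [hqf, query, mem_edgeConj_vars]
  constructor
  · rintro ⟨f, -, rfl | rfl⟩
    · exact ⟨_, rfl⟩
    · exact ⟨_, rfl⟩
  · rintro ⟨v, rfl⟩
    obtain ⟨f, rfl | rfl⟩ := he v
    · exact ⟨f, by simp, Or.inl rfl⟩
    · exact ⟨f, by simp, Or.inr rfl⟩

theorem isTreeGraph_query {e : t.Edge} (he : ∀ v, ∃ f, t.src f = v ∨ t.tgt f = v) :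
    (t.query e).formula.hypergraph.IsTreeGraph := by
  classical
  have hedge : ∀ s : Set ℕ, s ∈ (t.query e).formula.hypergraph.edgeSet ↔
      ∃ f, s = {t.varOf (t.src f), t.varOf (t.tgt f)} := by
    intro s
    constructor
    · rintro ⟨s, hs, rfl⟩
      obtain ⟨f, -, rfl⟩ := (t.mem_edgeConj_atomVars _ _ _).1 hs
      exact ⟨f, by simp⟩
    · rintro ⟨f, rfl⟩
      exact ⟨{t.varOf (t.src f), t.varOf (t.tgt f)},
        (t.mem_edgeConj_atomVars _ _ _).2 ⟨f, by simp, rfl⟩, by simp⟩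
  have hvert : ∀ x, x ∈ (t.query e).formula.hypergraph.vertexSet ↔ ∃ v, t.varOf v = x := by
    intro x
    rw [← mem_query_free_iff he]
    have hqf : (t.query e).formula.free = (t.query e).formula.vars :=
      t.edgeConj_isQuantifierFree e _
    rw [hqf]
    rfl
  constructor
  · intro s hs
    obtain ⟨f, rfl⟩ := (hedge s).1 hs
    exact Set.ncard_pair fun h => t.src_ne_tgt f (t.varOf_injective h)
  · let g : t.Vert → (t.query e).formula.hypergraph.vertexSet :=
      fun v => ⟨t.varOf v, (hvert _).2 ⟨v, rfl⟩⟩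
    have hg : Function.Bijective g := by
      constructor
      · exact fun u v h => t.varOf_injective (congrArg Subtype.val h)
      · rintro ⟨x, hx⟩
        obtain ⟨v, rfl⟩ := (hvert x).1 hx
        exact ⟨v, rfl⟩
    let iso : t.graph ≃g (t.query e).formula.hypergraph.primalGraph :=
      { toEquiv := Equiv.ofBijective g hg
        map_rel_iff' := by
          intro u v
          change (g u ≠ g v ∧ ∃ s ∈ (t.query e).formula.hypergraph.edgeSet,
            t.varOf u ∈ s ∧ t.varOf v ∈ s) ↔
            ∃ f, (t.src f = u ∧ t.tgt f = v) ∨ (t.src f = v ∧ t.tgt f = u)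
          constructor
          · rintro ⟨huv, s, hs, hu, hv⟩
            obtain ⟨f, rfl⟩ := (hedge s).1 hs
            have huv' : u ≠ v := fun h => huv (congrArg g h)
            simp only [Set.mem_insert_iff, Set.mem_singleton_iff, t.varOf_injective.eq_iff]
              at hu hv
            refine ⟨f, ?_⟩
            rcases hu with rfl | rfl <;> rcases hv with rfl | rfl <;> simp_all
          · rintro ⟨f, ⟨rfl, rfl⟩ | ⟨rfl, rfl⟩⟩
            · exact ⟨fun h => t.src_ne_tgt f (hg.1 h), _, (hedge _).2 ⟨f, rfl⟩, by simp, by simp⟩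
            · exact ⟨fun h => t.src_ne_tgt f (hg.1 h).symm, _, (hedge _).2 ⟨f, rfl⟩, by simp,
                by simp⟩ }
    exact iso.isTree_iff.1 t.isTree_graph

/-- Each relation pins the first coordinates of its arguments to the ends of its edge. As every
vertex lies on an edge, the solutions are exactly `v ↦ (v, b v)` with `b` consistent, and
substituting `weight v d` for the variable of `(v, d)` turns their monomials into weights of
labellings. -/
theorem isProjection_query {F τ : Type*} [Field F] {t : TreeNet Δ (F ⊕ τ)} {e : t.Edge}
    (he : ∀ v, ∃ f, t.src f = v ∨ t.tgt f = v) :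
    IsProjection (∑ d, t.val substValue d) ((t.query e).Q F) := by
  classical
  refine ⟨fun p => t.weight p.1 p.2, ?_⟩
  set φ := (t.query e).formula with hφ
  let g : t.Vert → φ.free := fun v => ⟨t.varOf v, (mem_query_free_iff he _).2 ⟨v, rfl⟩⟩
  have hg : Function.Bijective g := by
    constructor
    · exact fun u v h => t.varOf_injective (congrArg Subtype.val h)
    · rintro ⟨x, hx⟩
      obtain ⟨v, rfl⟩ := (mem_query_free_iff he x).1 hx
      exact ⟨v, rfl⟩
  let G : t.Vert ≃ φ.free := Equiv.ofBijective g hg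
  have hsol : ∀ a : φ.free → t.Vert × Δ, (t.query e).IsSolution a ↔ ∀ f,
      (a (g (t.src f))).1 = t.src f ∧ (a (g (t.tgt f))).1 = t.tgt f ∧
        t.rel f (a (g (t.src f))).2 (a (g (t.tgt f))).2 := by
    intro a
    refine ((t.query e).isSolution_iff a).trans ?_
    have key : ∀ w : ℕ → t.Vert × Δ, (∀ x : φ.free, w x = a x) →
        ((t.query e).formula.MatrixSat (t.query e).str w ↔ ∀ f,
          (a (g (t.src f))).1 = t.src f ∧ (a (g (t.tgt f))).1 = t.tgt f ∧
          t.rel f (a (g (t.src f))).2 (a (g (t.tgt f))).2) := by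
      intro w hw
      refine (t.edgeConj_matrixSat e _ w).trans ?_
      have hwg : ∀ v, w (t.varOf v) = a (g v) := fun v => hw (g v)
      simp only [hwg]
      exact ⟨fun h f => h f (by simp), fun h f _ => h f⟩
    constructor
    · rintro ⟨w, hs, hw⟩
      exact (key w hw).1 hs
    · intro h
      obtain ⟨w, hw⟩ : ∃ w : ℕ → t.Vert × Δ, ∀ x : φ.free, w x = a x :=
        ⟨fun x => if hx : x ∈ φ.free then a ⟨x, hx⟩ else a (g t.root), fun x => by simp⟩
      exact ⟨w, (key w hw).2 h, hw⟩
  rw [t.sum_val, ConjQuery.Q, map_sum]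
  refine Finset.sum_bij (fun b _ x => (G.symm x, b (G.symm x))) ?_ ?_ ?_ ?_
  · intro b hb
    refine Finset.mem_filter.2 ⟨Finset.mem_univ _, (hsol _).2 fun f => ?_⟩
    have hG : ∀ v, G.symm (g v) = v := fun v => G.symm_apply_apply v
    simp only [hG, true_and]
    exact (Finset.mem_filter.1 hb).2 f
  · intro b _ c _ h
    funext v
    have := congrArg Prod.snd (congrFun h (G v))
    simpa using this
  · intro a ha
    have ha' := (hsol a).1 (Finset.mem_filter.1 ha).2
    refine ⟨fun v => (a (G v)).2, Finset.mem_filter.2 ⟨Finset.mem_univ _, fun f => (ha' f).2.2⟩, ?_⟩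
    funext x
    obtain ⟨v, rfl⟩ := G.surjective x
    have hv : (a (G v)).1 = v := by
      obtain ⟨f, rfl | rfl⟩ := he v
      · exact (ha' f).1
      · exact (ha' f).2.1
    simp only [Equiv.symm_apply_apply]
    exact Prod.ext hv.symm rfl
  · intro b _
    rw [map_prod]
    refine Fintype.prod_equiv G _ _ fun v => ?_
    refine Eq.trans ?_ (MvPolynomial.aeval_X _ _).symm
    change _ = substValue (t.weight (G.symm (G v)) (b (G.symm (G v))))
    rw [Equiv.symm_apply_apply]

end TreeNet

/-! ### Homogeneous components and formal derivatives in a circuit -/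

section HomogeneousComponent

variable {F τ : Type*} [Field F]

theorem MvPolynomial.homogeneousComponent_mul (p q : MvPolynomial τ F) (n : ℕ) :
    homogeneousComponent n (p * q) =
      ∑ x ∈ Finset.HasAntidiagonal.antidiagonal n,
        homogeneousComponent x.1 p * homogeneousComponent x.2 q := by
  classical
  ext d
  rw [coeff_homogeneousComponent, coeff_sum]
  simp only [coeff_mul, coeff_homogeneousComponent]
  rw [Finset.sum_comm]
  have key : ∀ y ∈ Finset.HasAntidiagonal.antidiagonal d,
      (∑ x ∈ Finset.HasAntidiagonal.antidiagonal n,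
      (if y.1.degree = x.1 then coeff y.1 p else 0) * (if y.2.degree = x.2 then coeff y.2 q else 0))
      = if d.degree = n then coeff y.1 p * coeff y.2 q else 0 := by
    intro y hy
    have hdeg : d.degree = y.1.degree + y.2.degree := by
      rw [← Finset.HasAntidiagonal.mem_antidiagonal.1 hy, map_add]
    by_cases h : d.degree = n
    · rw [if_pos h, Finset.sum_eq_single (y.1.degree, y.2.degree)]
      · simp
      · rintro ⟨a, b⟩ - hne
        by_cases ha : y.1.degree = a
        · rw [if_neg (c := y.2.degree = b) fun hb => hne (by simp [ha, hb]), mul_zero]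
        · rw [if_neg ha, zero_mul]
      · intro hn
        exact absurd (Finset.HasAntidiagonal.mem_antidiagonal.2 (hdeg.symm.trans h)) hn
    · rw [if_neg h]
      refine Finset.sum_eq_zero fun x hx => ?_
      have hx' := Finset.HasAntidiagonal.mem_antidiagonal.1 hx
      by_cases ha : y.1.degree = x.1
      · rw [if_neg (c := y.2.degree = x.2) fun hb => h (by omega), mul_zero]
      · rw [if_neg ha, zero_mul]
  rw [Finset.sum_congr rfl key]
  split_ifs with h
  · rfl
  · simp

end HomogeneousComponent

namespace ArithCircuit

variable {F τ : Type*} (C : ArithCircuit F τ)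

/-- A gate of a circuit, its inputs being regarded as gates of the whole circuit. -/
def kind (i : Fin C.size) : ArithGate F τ C.size :=
  match C.gate i with
  | .const c => .const c
  | .var x => .var x
  | .add j k => .add (j.castLE i.2.le) (k.castLE i.2.le)
  | .mul j k => .mul (j.castLE i.2.le) (k.castLE i.2.le)

theorem lt_of_kind_eq_add {i j k : Fin C.size} (h : C.kind i = .add j k) : j < i ∧ k < i := by
  rw [kind] at h
  cases hg : C.gate i with
  | const c => simp [hg] at h
  | var x => simp [hg] at h
  | add a b =>
    simp only [hg, ArithGate.add.injEq] at h
    exact ⟨h.1 ▸ a.2, h.2 ▸ b.2⟩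
  | mul a b => simp [hg] at h

theorem lt_of_kind_eq_mul {i j k : Fin C.size} (h : C.kind i = .mul j k) : j < i ∧ k < i := by
  rw [kind] at h
  cases hg : C.gate i with
  | const c => simp [hg] at h
  | var x => simp [hg] at h
  | add a b => simp [hg] at h
  | mul a b =>
    simp only [hg, ArithGate.mul.injEq] at h
    exact ⟨h.1 ▸ a.2, h.2 ▸ b.2⟩

variable [Field F]

theorem value_eq_kind (i : Fin C.size) :
    C.value i = match C.kind i with
      | .const c => MvPolynomial.C c
      | .var x => MvPolynomial.X x
      | .add j k => C.value j + C.value k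
      | .mul j k => C.value j * C.value k := by
  rw [value_eq_gate_value, kind]
  cases C.gate i with
  | const c => rfl
  | var x => rfl
  | add j k => simp [ArithGate.value, j.2.trans i.2, k.2.trans i.2, Fin.castLE]
  | mul j k => simp [ArithGate.value, j.2.trans i.2, k.2.trans i.2, Fin.castLE]

/-- The homogeneous components of the polynomials computed at the gates. -/
noncomputable def comp (i : Fin C.size) (d : ℕ) : MvPolynomial τ F :=
  MvPolynomial.homogeneousComponent d (C.value i)

theorem comp_zero_mem (i : Fin C.size) :
    C.comp i 0 ∈ (⊥ : Subalgebra F (MvPolynomial τ F)) := by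
  rw [comp, MvPolynomial.homogeneousComponent_zero]
  exact Subalgebra.algebraMap_mem _ _

/-- The derivation step: the part of the derivative at a gate that comes from its inputs. -/
noncomputable def inner (g : Fin C.size → ℕ → MvPolynomial τ F) (i : Fin C.size) (d : ℕ) :
    MvPolynomial τ F :=
  match C.kind i with
  | .const _ => 0
  | .var _ => 0
  | .add j k => g j d + g k d
  | .mul j k => ∑ x ∈ Finset.HasAntidiagonal.antidiagonal d,
      (g j x.1 * C.comp k x.2 + C.comp j x.1 * g k x.2)

theorem inner_congr {g g' : Fin C.size → ℕ → MvPolynomial τ F} {i : Fin C.size} {d : ℕ}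
    (h : ∀ j < i, ∀ d' ≤ d, g j d' = g' j d') : C.inner g i d = C.inner g' i d := by
  unfold inner
  cases hk : C.kind i with
  | const c => rfl
  | var x => rfl
  | add j k =>
    obtain ⟨hj, hk'⟩ := C.lt_of_kind_eq_add hk
    simp only [h j hj d le_rfl, h k hk' d le_rfl]
  | mul j k =>
    obtain ⟨hj, hk'⟩ := C.lt_of_kind_eq_mul hk
    refine Finset.sum_congr rfl fun x hx => ?_
    have hx' := Finset.HasAntidiagonal.mem_antidiagonal.1 hx
    rw [h j hj x.1 (by omega), h k hk' x.2 (by omega)]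

theorem inner_sum_mul {ι : Type*} (s : Finset ι) (g : ι → Fin C.size → ℕ → MvPolynomial τ F)
    (c : ι → MvPolynomial τ F) (i : Fin C.size) (d : ℕ) :
    ∑ a ∈ s, C.inner (g a) i d * c a = C.inner (fun j d => ∑ a ∈ s, g a j d * c a) i d := by
  simp only [inner]
  cases C.kind i with
  | const c => simp
  | var x => simp
  | add j k => simp only [add_mul, Finset.sum_add_distrib]
  | mul j k =>
    simp only [Finset.sum_mul, Finset.mul_sum, ← Finset.sum_add_distrib]
    rw [Finset.sum_comm]
    exact Finset.sum_congr rfl fun x _ => Finset.sum_congr rfl fun a _ => by ring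

/-- The derivative of the degree `d` part at gate `i` by the degree `e` part at gate `v`. -/
noncomputable def context (v : Fin C.size) (e : ℕ) (i : Fin C.size) (d : ℕ) : MvPolynomial τ F :=
  (if i = v ∧ d = e then 1 else 0) +
    C.inner (fun j d' => if _h : j < i then context v e j d' else 0) i d
termination_by i

theorem context_eq (v : Fin C.size) (e : ℕ) (i : Fin C.size) (d : ℕ) :
    C.context v e i d =
      (if i = v ∧ d = e then 1 else 0) + C.inner (C.context v e) i d := by
  rw [context]
  exact congrArg _ (C.inner_congr fun j hj d' _ => dif_pos hj)

/-- A derivative of a degree `d` part by a degree `e` part has degree `d - e`. -/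
theorem context_eq_zero_of_lt {v i : Fin C.size} {d e : ℕ} (h : d < e) :
    C.context v e i d = 0 := by
  induction i using WellFoundedLT.induction generalizing d with
  | _ i ih =>
    rw [context_eq, if_neg fun h' => h.ne h'.2, zero_add,
      C.inner_congr (g' := fun _ _ => 0) fun j hj d' hd' => ih j hj (hd'.trans_lt h)]
    simp only [inner]
    cases C.kind i <;> simp

theorem context_mem_of_eq (v i : Fin C.size) (e : ℕ) :
    C.context v e i e ∈ (⊥ : Subalgebra F (MvPolynomial τ F)) := by
  induction i using WellFoundedLT.induction with
  | _ i ih =>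
    rw [context_eq]
    refine add_mem ?_ ?_
    · split_ifs
      · exact one_mem _
      · exact zero_mem _
    · rw [inner]
      cases hk : C.kind i with
      | const c => exact zero_mem _
      | var x => exact zero_mem _
      | add j k =>
        obtain ⟨hj, hk'⟩ := C.lt_of_kind_eq_add hk
        exact add_mem (ih j hj) (ih k hk')
      | mul j k =>
        obtain ⟨hj, hk'⟩ := C.lt_of_kind_eq_mul hk
        refine sum_mem fun x hx => ?_
        have hx' := Finset.HasAntidiagonal.mem_antidiagonal.1 hx
        refine add_mem ?_ ?_
        · by_cases h : x.1 < e
          · rw [C.context_eq_zero_of_lt h, zero_mul]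
            exact zero_mem _
          · rw [show x.1 = e by omega, show x.2 = 0 by omega]
            exact mul_mem (ih j hj) (C.comp_zero_mem k)
        · by_cases h : x.2 < e
          · rw [C.context_eq_zero_of_lt h, mul_zero]
            exact zero_mem _
          · rw [show x.2 = e by omega, show x.1 = 0 by omega]
            exact mul_mem (C.comp_zero_mem j) (ih k hk')

/-- Expansion along the gates at which the degree drops to at most `θ`. -/
theorem sum_context_mul {θ D : ℕ} {g h : Fin C.size → ℕ → MvPolynomial τ F}
    (hzero : ∀ i, ∀ d ≤ θ, g i d = 0)
    (hstep : ∀ i d, θ < d → d ≤ D → g i d = h i d + C.inner g i d) (i : Fin C.size) {d : ℕ}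
    (hd : d ≤ D) :
    ∑ p ∈ Finset.univ ×ˢ Finset.Ioc θ D, C.context p.1 p.2 i d * h p.1 p.2 = g i d := by
  induction i using WellFoundedLT.induction generalizing d with
  | _ i ih =>
    rcases Nat.lt_or_ge θ d with hθ | hθ
    · simp only [C.context_eq _ _ i d, add_mul, Finset.sum_add_distrib]
      rw [C.inner_sum_mul _ (fun p : Fin C.size × ℕ => C.context p.1 p.2) (fun p => h p.1 p.2) i d,
        C.inner_congr fun j hj d' hd' => ih j hj (hd'.trans hd), hstep i d hθ hd]
      refine congrArg (· + C.inner g i d) ?_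
      rw [Finset.sum_eq_single (i, d)]
      · simp
      · rintro ⟨w, e⟩ - hne
        rw [if_neg fun h' => hne (Prod.ext h'.1.symm h'.2.symm), zero_mul]
      · intro hn
        exact absurd (Finset.mem_product.2 ⟨Finset.mem_univ _, Finset.mem_Ioc.2 ⟨hθ, hd⟩⟩) hn
    · rw [hzero i d hθ]
      refine Finset.sum_eq_zero fun p hp => ?_
      have hp' := Finset.mem_Ioc.1 (Finset.mem_product.1 hp).2
      rw [C.context_eq_zero_of_lt (by omega), zero_mul]

/-- The variable at an input gate. -/
noncomputable def inputVar (i : Fin C.size) : MvPolynomial τ F :=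
  match C.kind i with
  | .var x => MvPolynomial.X x
  | _ => 0

/-- The part of the degree `d` component at a gate that comes from inputs of degree at
most `θ`. -/
noncomputable def lowPart (θ : ℕ) (i : Fin C.size) (d : ℕ) : MvPolynomial τ F :=
  match C.kind i with
  | .mul j k => ∑ x ∈ Finset.HasAntidiagonal.antidiagonal d,
      if x.1 ≤ θ ∧ x.2 ≤ θ then C.comp j x.1 * C.comp k x.2 else 0
  | _ => if d = 1 then C.inputVar i else 0

/-- Truncating the components at `θ` makes them satisfy the recursion with source `lowPart`. Since
`d ≤ 2 * θ + 1`, at most one factor of a product has degree above `θ`, so the product rule counts no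
term twice. -/
theorem comp_eq_sum {θ d : ℕ} (i : Fin C.size) (hθ : θ < d) (hd : d ≤ 2 * θ + 1) :
    C.comp i d = ∑ p ∈ Finset.univ ×ˢ Finset.Ioc θ (2 * θ + 1),
      C.context p.1 p.2 i d * C.lowPart θ p.1 p.2 := by
  rw [C.sum_context_mul (g := fun i d => if θ < d then C.comp i d else 0)
    (fun i d hd => if_neg (by omega)) (fun i d hθ hd => ?_) i hd, if_pos hθ]
  simp only [if_pos hθ]
  have hval := C.value_eq_kind i
  rw [show C.comp i d = MvPolynomial.homogeneousComponent d (C.value i) from rfl]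
  unfold lowPart inner inputVar
  cases hk : C.kind i with
  | const c =>
    simp only [hk] at hval ⊢
    rw [hval, MvPolynomial.homogeneousComponent_of_mem (MvPolynomial.isHomogeneous_C τ c),
      if_neg (by omega)]
    simp
  | var x =>
    simp only [hk] at hval ⊢
    rw [hval, MvPolynomial.homogeneousComponent_of_mem (MvPolynomial.isHomogeneous_X F x),
      add_zero]
  | add j k =>
    simp only [hk] at hval ⊢
    rw [hval, map_add, if_pos hθ, if_pos hθ]
    simp [comp]
  | mul j k =>
    simp only [hk] at hval ⊢
    rw [hval, MvPolynomial.homogeneousComponent_mul, ← Finset.sum_add_distrib]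
    refine Finset.sum_congr rfl fun x hx => ?_
    have hx' := Finset.HasAntidiagonal.mem_antidiagonal.1 hx
    change C.comp j x.1 * C.comp k x.2 = _
    rcases Nat.lt_or_ge θ x.1 with h₁ | h₁
    · rw [if_pos h₁, if_neg (c := θ < x.2) (by omega), if_neg (by omega)]
      ring
    · rcases Nat.lt_or_ge θ x.2 with h₂ | h₂
      · rw [if_neg (c := θ < x.1) (by omega), if_pos h₂, if_neg (by omega)]
        ring
      · rw [if_neg (c := θ < x.1) (by omega), if_neg (c := θ < x.2) (by omega), if_pos ⟨h₁, h₂⟩]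
        ring

/-- The part of a derivative at a gate that comes from inputs of degree at most `θ` on the path
to the gate `v`. -/
noncomputable def lowContext (v : Fin C.size) (e θ : ℕ) (i : Fin C.size) (d : ℕ) :
    MvPolynomial τ F :=
  match C.kind i with
  | .mul j k => ∑ x ∈ Finset.HasAntidiagonal.antidiagonal d,
      ((if x.1 ≤ θ then C.context v e j x.1 * C.comp k x.2 else 0) +
        if x.2 ≤ θ then C.comp j x.1 * C.context v e k x.2 else 0)
  | _ => 0

/-- Here a threshold `θ ≥ e` cuts the derivative. Above it the diagonal term is absent, and the
source consists of the products in which the differentiated factor has degree at most `θ`. -/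
theorem context_eq_sum {v : Fin C.size} {e θ d D : ℕ} (i : Fin C.size) (he : e ≤ θ) (hθ : θ < d)
    (hd : d ≤ D) :
    C.context v e i d = ∑ p ∈ Finset.univ ×ˢ Finset.Ioc θ D,
      C.context p.1 p.2 i d * C.lowContext v e θ p.1 p.2 := by
  rw [C.sum_context_mul (g := fun i d => if θ < d then C.context v e i d else 0)
    (fun i d hd => if_neg (by omega)) (fun i d hθ hd => ?_) i hd, if_pos hθ]
  simp only [if_pos hθ]
  rw [C.context_eq v e i d, if_neg fun h => by omega, zero_add]
  unfold lowContext inner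
  cases hk : C.kind i with
  | const c => simp
  | var x => simp
  | add j k => simp [hθ]
  | mul j k =>
    simp only
    rw [← Finset.sum_add_distrib]
    refine Finset.sum_congr rfl fun x _ => ?_
    rcases Nat.lt_or_ge θ x.1 with h₁ | h₁ <;> rcases Nat.lt_or_ge θ x.2 with h₂ | h₂ <;>
      simp [h₁, h₂, Nat.not_le.2, Nat.not_lt.2]
    ring

end ArithCircuit

/-! ### One tree for a whole family of polynomials -/

section Represented

variable {F τ : Type*} [Field F] {ι : Type}

/-- The span of the products of three members of a family of polynomials. -/
noncomputable def tripleSpan (p : ι → MvPolynomial τ F) : Submodule F (MvPolynomial τ F) :=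
  Submodule.span F (Set.range fun x : ι × ι × ι => p x.1 * p x.2.1 * p x.2.2)

theorem mul_mul_mem_tripleSpan {p : ι → MvPolynomial τ F} {a b c : MvPolynomial τ F}
    (ha : a ∈ Set.range p) (hb : b ∈ Set.range p) (hc : c ∈ Set.range p) :
    a * b * c ∈ tripleSpan p := by
  obtain ⟨i, rfl⟩ := ha
  obtain ⟨j, rfl⟩ := hb
  obtain ⟨k, rfl⟩ := hc
  exact Submodule.subset_span ⟨(i, j, k), rfl⟩

theorem mem_tripleSpan_of_mem_range {p : ι → MvPolynomial τ F} {a : MvPolynomial τ F}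
    (ha : a ∈ Set.range p) (h₁ : 1 ∈ Set.range p) : a ∈ tripleSpan p := by
  simpa using mul_mul_mem_tripleSpan ha h₁ h₁

variable [Fintype ι]

open scoped Classical in
/-- The members of the family are partial sums of the polynomials computed at the root of a tree
with at most `N` vertices, for the labels at the root. -/
def IsRepresented (N : ℕ) (p : ι → MvPolynomial τ F) : Prop :=
  ∃ t : TreeNet (ι × ι × ι × ι) (F ⊕ τ), t.size ≤ N ∧ ∃ ρ : ι → ι × ι × ι × ι → Prop,
    ∀ i, p i = ∑ d, if ρ i d then t.val substValue d else 0

theorem isRepresented_of_mem_range {p : ι → MvPolynomial τ F}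
    (h : ∀ i, p i ∈ Set.range (substValue : F ⊕ τ → MvPolynomial τ F)) : IsRepresented 1 p := by
  classical
  choose w hw using h
  refine ⟨.leaf fun d => w d.1, le_rfl, fun i d => d = (i, i, i, i), fun i => ?_⟩
  simp only [TreeNet.val, hw]
  rw [Finset.sum_eq_single (i, i, i, i)]
  · simp
  · intro d _ hd
    simp [hd]
  · simp

/-- The root label `(i, x, y, z)` chooses a member `i` and a triple in its expansion, with the
coefficient as weight. The relations to three copies of `t` let these sum to `p x`, `p y` and `p z`.
So arbitrarily many terms for all `i` cost only three copies of the tree, and the label set stays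
the same from step to step. -/
theorem IsRepresented.step {N : ℕ} {p q : ι → MvPolynomial τ F} (hp : IsRepresented N p)
    (hq : ∀ i, q i ∈ tripleSpan p) : IsRepresented (3 * N + 1) q := by
  classical
  obtain ⟨t, ht, ρ, hρ⟩ := hp
  have hc : ∀ i, ∃ c : ι × ι × ι → F, ∑ x, c x • (p x.1 * p x.2.1 * p x.2.2) = q i :=
    fun i => (Submodule.mem_span_range_iff_exists_fun F).1 (hq i)
  choose c hc using hc
  let u : TreeNet (ι × ι × ι × ι) (F ⊕ τ) :=
    .graft (.graft (.graft (.leaf fun d => Sum.inl (c d.1 d.2)) (fun d => ρ d.2.1) t)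
      (fun d => ρ d.2.2.1) t) (fun d => ρ d.2.2.2) t
  refine ⟨u, ?_, fun i d => d.1 = i, fun i => ?_⟩
  · simp only [u, TreeNet.size]
    omega
  · have hu : ∀ d, u.val substValue d =
        c d.1 d.2 • (p d.2.1 * p d.2.2.1 * p d.2.2.2) := by
      intro d
      simp only [u, TreeNet.val, ← hρ, MvPolynomial.smul_eq_C_mul]
      simp only [substValue, Sum.elim_inl]
      ring
    simp only [hu]
    rw [Fintype.sum_prod_type, ← hc i]
    simp only
    rw [Finset.sum_eq_single i]
    · simp
    · intro j _ hj
      simp [hj]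
    · simp

end Represented

/-! ### Depth reduction: doubling the degree bound -/

namespace ArithCircuit

variable {F τ : Type*} [Field F] (C : ArithCircuit F τ)

/-- Indices for the constant `1`, the input variables, the homogeneous components, and the
derivatives of homogeneous components by others. -/
abbrev Item (s D : ℕ) : Type :=
  Unit ⊕ Fin s ⊕ (Fin s × Fin (D + 1)) ⊕ ((Fin s × Fin (D + 1)) × (Fin s × Fin (D + 1)))

theorem card_item (s D : ℕ) :
    Fintype.card (Item s D) = 1 + (s + (s * (D + 1) + s * (D + 1) * (s * (D + 1)))) := by
  simp [Item]

/-- The polynomials of the items; the components of degree more than `a` and the derivatives of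
degree more than `b` are omitted. -/
noncomputable def itemValue (D a b : ℕ) : Item C.size D → MvPolynomial τ F
  | .inl _ => 1
  | .inr (.inl w) => C.inputVar w
  | .inr (.inr (.inl (i, d))) => if (d : ℕ) ≤ a then C.comp i d else 0
  | .inr (.inr (.inr ((i, d), (v, e)))) => if (d : ℕ) ≤ e + b then C.context v e i d else 0

variable {C} {D a b : ℕ}

theorem one_mem_range_itemValue : 1 ∈ Set.range (C.itemValue D a b) := ⟨.inl (), rfl⟩

theorem inputVar_mem_range_itemValue (w : Fin C.size) :
    C.inputVar w ∈ Set.range (C.itemValue D a b) := ⟨.inr (.inl w), rfl⟩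

theorem comp_mem_range_itemValue (i : Fin C.size) {d : ℕ} (hD : d ≤ D) (hd : d ≤ a) :
    C.comp i d ∈ Set.range (C.itemValue D a b) :=
  ⟨.inr (.inr (.inl (i, ⟨d, Nat.lt_succ_of_le hD⟩))), if_pos hd⟩

theorem context_mem_range_itemValue (i v : Fin C.size) {d e : ℕ} (hD : d ≤ D) (he : e ≤ D)
    (hd : d ≤ e + b) : C.context v e i d ∈ Set.range (C.itemValue D a b) :=
  ⟨.inr (.inr (.inr ((i, ⟨d, Nat.lt_succ_of_le hD⟩), (v, ⟨e, Nat.lt_succ_of_le he⟩)))),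
    if_pos hd⟩

/-- With threshold `h`, the crossing gates have degree at least `h + 1`, so the derivatives by them
have degree at most `h`, and the two factors below have degree at most `h` by construction. -/
theorem comp_mem_tripleSpan {h : ℕ} (i : Fin C.size) {d : ℕ} (hD : d ≤ D) (hd : d ≤ 2 * h + 1) :
    C.comp i d ∈ tripleSpan (C.itemValue D h h) := by
  rcases Nat.lt_or_ge h d with hh | hh
  · rw [C.comp_eq_sum i hh hd]
    refine Submodule.sum_mem _ fun p hp => ?_
    have hp' := Finset.mem_Ioc.1 (Finset.mem_product.1 hp).2
    rcases Nat.lt_or_ge d p.2 with hlt | hle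
    · rw [C.context_eq_zero_of_lt hlt, zero_mul]
      exact Submodule.zero_mem _
    · have hctx : C.context p.1 p.2 i d ∈ Set.range (C.itemValue D h h) :=
        context_mem_range_itemValue i p.1 hD (hle.trans hD) (by omega)
      have hinput : C.context p.1 p.2 i d * (if p.2 = 1 then C.inputVar p.1 else 0) ∈
          tripleSpan (C.itemValue D h h) := by
        split_ifs
        · rw [← mul_one (_ * _)]
          exact mul_mul_mem_tripleSpan hctx (inputVar_mem_range_itemValue p.1)
            one_mem_range_itemValue
        · rw [mul_zero]
          exact Submodule.zero_mem _
      unfold lowPart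
      cases C.kind p.1 with
      | const c => exact hinput
      | var x => exact hinput
      | add j k => exact hinput
      | mul j k =>
        simp only
        rw [Finset.mul_sum]
        refine Submodule.sum_mem _ fun x hx => ?_
        have hx' := Finset.HasAntidiagonal.mem_antidiagonal.1 hx
        split_ifs with hlow
        · rw [← mul_assoc]
          exact mul_mul_mem_tripleSpan hctx (comp_mem_range_itemValue j (by omega) hlow.1)
            (comp_mem_range_itemValue k (by omega) hlow.2)
        · rw [mul_zero]
          exact Submodule.zero_mem _
  · exact mem_tripleSpan_of_mem_range (comp_mem_range_itemValue i hD hh) one_mem_range_itemValue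

/-- With threshold `e + h`, both derivatives in a term have degree at most `h`. The side factor may
have degree up to `2 * h + 1`, which is why the components are extended before the derivatives. -/
theorem context_mem_tripleSpan {h : ℕ} (i v : Fin C.size) {d e : ℕ} (hD : d ≤ D) (he : e ≤ D)
    (hd : d ≤ e + (2 * h + 1)) :
    C.context v e i d ∈ tripleSpan (C.itemValue D (2 * h + 1) h) := by
  rcases Nat.lt_or_ge (e + h) d with hh | hh
  · rw [C.context_eq_sum i (Nat.le_add_right e h) hh le_rfl]
    refine Submodule.sum_mem _ fun p hp => ?_
    have hp' := Finset.mem_Ioc.1 (Finset.mem_product.1 hp).2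
    have hctx : C.context p.1 p.2 i d ∈ Set.range (C.itemValue D (2 * h + 1) h) :=
      context_mem_range_itemValue i p.1 hD (by omega) (by omega)
    have hside : ∀ (j k : Fin C.size) (x y : ℕ), x + y = p.2 →
        C.context p.1 p.2 i d * (if x ≤ e + h then C.context v e j x * C.comp k y else 0) ∈
          tripleSpan (C.itemValue D (2 * h + 1) h) := by
      intro j k x y hxy
      split_ifs with hx
      · rcases Nat.lt_or_ge x e with hlt | hle
        · rw [C.context_eq_zero_of_lt hlt, zero_mul, mul_zero]
          exact Submodule.zero_mem _
        · rw [← mul_assoc]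
          exact mul_mul_mem_tripleSpan hctx
            (context_mem_range_itemValue j v (by omega) he hx)
            (comp_mem_range_itemValue k (by omega) (by omega))
      · rw [mul_zero]
        exact Submodule.zero_mem _
    unfold lowContext
    cases C.kind p.1 with
    | const c => simp
    | var x => simp
    | add j k => simp
    | mul j k =>
      simp only
      rw [Finset.mul_sum]
      refine Submodule.sum_mem _ fun x hx => ?_
      have hx' := Finset.HasAntidiagonal.mem_antidiagonal.1 hx
      rw [mul_add, mul_comm (C.comp j x.1)]
      exact Submodule.add_mem _ (hside j k x.1 x.2 hx') (hside k j x.2 x.1 (by omega))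
  · exact mem_tripleSpan_of_mem_range (context_mem_range_itemValue i v hD he hh)
      one_mem_range_itemValue

theorem itemValue_mem_tripleSpan_of_comp {h : ℕ} (x : Item C.size D) :
    C.itemValue D (2 * h + 1) h x ∈ tripleSpan (C.itemValue D h h) := by
  rcases x with _ | w | ⟨i, d⟩ | ⟨⟨i, d⟩, ⟨v, e⟩⟩
  · exact mem_tripleSpan_of_mem_range one_mem_range_itemValue one_mem_range_itemValue
  · exact mem_tripleSpan_of_mem_range (inputVar_mem_range_itemValue w) one_mem_range_itemValue
  · simp only [itemValue]
    split_ifs with hd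
    · exact comp_mem_tripleSpan i (Nat.le_of_lt_succ d.2) hd
    · exact Submodule.zero_mem _
  · exact mem_tripleSpan_of_mem_range ⟨.inr (.inr (.inr ((i, d), (v, e)))), rfl⟩
      one_mem_range_itemValue

theorem itemValue_mem_tripleSpan_of_context {h : ℕ} (x : Item C.size D) :
    C.itemValue D (2 * h + 1) (2 * h + 1) x ∈ tripleSpan (C.itemValue D (2 * h + 1) h) := by
  rcases x with _ | w | ⟨i, d⟩ | ⟨⟨i, d⟩, ⟨v, e⟩⟩
  · exact mem_tripleSpan_of_mem_range one_mem_range_itemValue one_mem_range_itemValue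
  · exact mem_tripleSpan_of_mem_range (inputVar_mem_range_itemValue w) one_mem_range_itemValue
  · exact mem_tripleSpan_of_mem_range ⟨.inr (.inr (.inl (i, d))), rfl⟩ one_mem_range_itemValue
  · simp only [itemValue]
    split_ifs with hd
    · exact context_mem_tripleSpan i v (Nat.le_of_lt_succ d.2) (Nat.le_of_lt_succ e.2) hd
    · exact Submodule.zero_mem _

theorem mem_range_substValue_of_mem_bot {p : MvPolynomial τ F}
    (h : p ∈ (⊥ : Subalgebra F (MvPolynomial τ F))) :
    p ∈ Set.range (substValue : F ⊕ τ → MvPolynomial τ F) := by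
  obtain ⟨c, rfl⟩ := Algebra.mem_bot.1 h
  exact ⟨.inl c, rfl⟩

/-- Components and derivatives of degree `0` are constants, and the other items are `1`, input
variables or `0`. -/
theorem isRepresented_itemValue_zero : IsRepresented 1 (C.itemValue D 0 0) := by
  refine isRepresented_of_mem_range fun x => ?_
  rcases x with _ | w | ⟨i, d⟩ | ⟨⟨i, d⟩, ⟨v, e⟩⟩
  · exact mem_range_substValue_of_mem_bot (one_mem _)
  · simp only [itemValue, inputVar]
    cases C.kind w with
    | var x => exact ⟨.inr x, rfl⟩
    | const c => exact mem_range_substValue_of_mem_bot (zero_mem _)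
    | add j k => exact mem_range_substValue_of_mem_bot (zero_mem _)
    | mul j k => exact mem_range_substValue_of_mem_bot (zero_mem _)
  · refine mem_range_substValue_of_mem_bot ?_
    simp only [itemValue]
    split_ifs with hd
    · rw [Nat.le_zero.1 hd]
      exact C.comp_zero_mem i
    · exact zero_mem _
  · refine mem_range_substValue_of_mem_bot ?_
    simp only [itemValue]
    split_ifs with hd
    · rcases Nat.lt_or_ge (d : ℕ) e with hlt | hle
      · rw [C.context_eq_zero_of_lt hlt]
        exact zero_mem _
      · rw [show (d : ℕ) = e by omega]
        exact C.context_mem_of_eq v i e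
    · exact zero_mem _

/-- A round has two steps, one for components and one for derivatives. It takes `N` to `9 * N + 4`,
so `N + 1` grows by a factor of at most nine, while the bound `h` becomes `2 * h + 1`. -/
theorem exists_isRepresented_itemValue (k : ℕ) :
    ∃ N, N + 1 ≤ 2 * 9 ^ k ∧ IsRepresented N (C.itemValue D (2 ^ k - 1) (2 ^ k - 1)) := by
  induction k with
  | zero => exact ⟨1, le_rfl, isRepresented_itemValue_zero⟩
  | succ k ih =>
    obtain ⟨N, hN, hrep⟩ := ih
    have hk : 2 ^ (k + 1) - 1 = 2 * (2 ^ k - 1) + 1 := by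
      have := Nat.one_le_two_pow (n := k)
      rw [pow_succ]
      omega
    rw [hk]
    refine ⟨3 * (3 * N + 1) + 1, ?_, (hrep.step itemValue_mem_tripleSpan_of_comp).step
      itemValue_mem_tripleSpan_of_context⟩
    rw [pow_succ]
    omega

/-- Every circuit can be unfolded to a tree of size polynomial in the size of the circuit and the
degree. -/
theorem exists_treeNet (C : ArithCircuit F τ) :
    ∃ (Δ : Type) (_ : Fintype Δ) (_ : Nonempty Δ) (t s : TreeNet Δ (F ⊕ τ)) (R : Δ → Δ → Prop),
      C.poly = ∑ d, (TreeNet.graft t R s).val substValue d ∧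
      (TreeNet.graft t R s).size ≤ 6 * (2 * (C.poly.totalDegree + 1)) ^ 4 ∧
      Fintype.card Δ = (1 + (C.size + (C.size * (C.poly.totalDegree + 1) +
        C.size * (C.poly.totalDegree + 1) * (C.size * (C.poly.totalDegree + 1))))) ^ 4 := by
  classical
  set D := C.poly.totalDegree with hD
  -- The bound `2 ^ K - 1` exceeds the degree, so every component of the output is an item, while `9
  -- ^ K ≤ (2 ^ K) ^ 4` stays polynomial because `2 ^ K ≤ 2 * (D + 1)`.
  set K := Nat.log 2 (D + 1) + 1 with hK
  obtain ⟨N, hN, hrep⟩ := exists_isRepresented_itemValue (C := C) (D := D) K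
  have hlt : D + 1 < 2 ^ K := Nat.lt_pow_succ_log_self (by norm_num) _
  have hle : 2 ^ K ≤ 2 * (D + 1) := by
    rw [hK, pow_succ, mul_comm]
    exact Nat.mul_le_mul_left 2 (Nat.pow_log_le_self 2 (by omega))
  have hpoly : C.poly ∈ tripleSpan (C.itemValue D (2 ^ K - 1) (2 ^ K - 1)) := by
    rw [← MvPolynomial.sum_homogeneousComponent C.poly]
    refine Submodule.sum_mem _ fun d hd => ?_
    have hd' := Finset.mem_range.1 hd
    exact mem_tripleSpan_of_mem_range
      (comp_mem_range_itemValue C.output (by omega) (by omega)) one_mem_range_itemValue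
  -- One more step adds up the homogeneous components of the output.
  obtain ⟨t, ht, ρ, hρ⟩ := hrep.step (q := fun _ => C.poly) fun _ => hpoly
  let Δ := Item C.size D × Item C.size D × Item C.size D × Item C.size D
  let d₀ : Δ := (.inl (), .inl (), .inl (), .inl ())
  -- A new root of weight `1` at the single label `d₀` turns the partial sum selected by `ρ` into a
  -- sum over all root labels. It also ensures that the tree has an edge, hence that the query has
  -- an atom.
  refine ⟨Δ, inferInstance, ⟨d₀⟩,
    .leaf fun d => Sum.inl (if d = d₀ then 1 else 0), t, fun _ => ρ (.inl ()), ?_, ?_, ?_⟩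
  · have h₀ : ∑ d, (if ρ (.inl ()) d then t.val substValue d else 0) = C.poly :=
      (hρ (.inl ())).symm
    simp only [TreeNet.val]
    rw [Finset.sum_eq_single d₀]
    · rw [h₀]
      simp [substValue]
    · intro d _ hd
      simp [substValue, hd]
    · simp
  · have h₁ : 9 ^ K ≤ (2 * (D + 1)) ^ 4 :=
      calc 9 ^ K ≤ (2 ^ 4) ^ K := Nat.pow_le_pow_left (by norm_num) K
        _ = (2 ^ K) ^ 4 := by rw [← pow_mul, ← pow_mul, mul_comm]
        _ ≤ _ := Nat.pow_le_pow_left hle 4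
    simp only [TreeNet.size]
    omega
  · simp only [Δ, Fintype.card_prod, card_item]
    ring

end ArithCircuit

/-! ### The characterization of VP -/

/-- Every family in `VP` is a `p`-projection of the polynomials of quantifier-free queries of
polynomially bounded size whose hypergraphs are trees. -/
theorem IsVP.exists_isPProjection_Q {F : Type*} [Field F] {τ : ℕ → Type*}
    {f : ∀ n, MvPolynomial (τ n) F} (hf : IsVP f) :
    ∃ Φ : ℕ → ConjQuery, PolyBounded (fun n => (Φ n).size) ∧
      (∀ n, (Φ n).formula.IsQuantifierFree ∧ (Φ n).formula.hypergraph.IsTreeGraph) ∧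
      IsPProjection f (fun n => (Φ n).Q F) := by
  obtain ⟨hdeg, C, hC, hsize⟩ := hf
  have key : ∀ n, ∃ Φ : ConjQuery,
      (Φ.formula.IsQuantifierFree ∧ Φ.formula.hypergraph.IsTreeGraph) ∧
      IsProjection (f n) (Φ.Q F) ∧ ∃ a b : ℕ, Φ.size ≤ 4 * a + a * b + a * (a * b) ^ 2 ∧
        a ≤ 6 * (2 * ((f n).totalDegree + 1)) ^ 4 ∧
        b = (1 + ((C n).size + ((C n).size * ((f n).totalDegree + 1) +
          (C n).size * ((f n).totalDegree + 1) *
            ((C n).size * ((f n).totalDegree + 1))))) ^ 4 := by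
    intro n
    obtain ⟨Δ, _, _, t, s, R, hpoly, hts, hΔ⟩ := (C n).exists_treeNet
    rw [hC n] at hpoly hts hΔ
    have he : ∀ v, ∃ e, (TreeNet.graft t R s).src e = v ∨ (TreeNet.graft t R s).tgt e = v :=
      TreeNet.exists_edge_of_graft t R s
    refine ⟨(TreeNet.graft t R s).query none,
      ⟨(TreeNet.graft t R s).edgeConj_isQuantifierFree none _, TreeNet.isTreeGraph_query he⟩,
      ?_, _, _, (TreeNet.graft t R s).query_size_le none, hts, hΔ⟩
    rw [hpoly]
    exact TreeNet.isProjection_query he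
  choose Φ hΦ hproj a b hsz ha hb using key
  have h₁ : PolyBounded fun n => (f n).totalDegree + 1 := hdeg.add (.const 1)
  have h₂ := hsize.mul h₁
  have hb' : PolyBounded b := by
    simp only [funext hb]
    exact ((PolyBounded.const 1).add (hsize.add (h₂.add (h₂.mul h₂)))).pow 4
  have ha' : PolyBounded a :=
    ((PolyBounded.const 6).mul (((PolyBounded.const 2).mul h₁).pow 4)).mono ha
  refine ⟨Φ, PolyBounded.mono ((((PolyBounded.const 4).mul ha').add (ha'.mul hb')).add
    (ha'.mul ((ha'.mul hb').pow 2))) hsz, hΦ, .X, fun n => ?_⟩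
  rw [Polynomial.eval_X]
  exact hproj n

theorem mainTheorem7 (F : Type*) [Field F] :
    (∀ Φ : ℕ → ConjQuery, (∀ n, (Φ n).IsACQ) → PolyBounded (fun n => (Φ n).size) →
      (∃ k : ℕ, ∀ n, (Φ n).formula.quantifiedStarSize ≤ k) →
      IsVP (fun n => (Φ n).Q F)) ∧
    (∀ (τ : ℕ → Type*) (f : ∀ n, MvPolynomial (τ n) F),
      (IsVP f ↔ ∃ Φ : ℕ → ConjQuery, PolyBounded (fun n => (Φ n).size) ∧
        (∀ n, (Φ n).formula.IsQuantifierFree ∧ (Φ n).formula.hypergraph.IsTreeGraph) ∧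
        IsPProjection f (fun n => (Φ n).Q F)) ∧
      (IsVP f ↔ ∃ Φ : ℕ → ConjQuery, PolyBounded (fun n => (Φ n).size) ∧
        (∀ n, (Φ n).IsACQ) ∧ (∃ k : ℕ, ∀ n, (Φ n).formula.quantifiedStarSize ≤ k) ∧
        IsPProjection f (fun n => (Φ n).Q F))) := by
  have hstar : ∀ Φ : ℕ → ConjQuery, (∀ n, (Φ n).formula.IsQuantifierFree ∧
      (Φ n).formula.hypergraph.IsTreeGraph) →
      (∀ n, (Φ n).IsACQ) ∧ ∃ k : ℕ, ∀ n, (Φ n).formula.quantifiedStarSize ≤ k :=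
    fun Φ h => ⟨fun n => ConjQuery.isACQ_of_isTreeGraph (h n).2,
      0, fun n => (h n).1.quantifiedStarSize_eq_zero.le⟩
  refine ⟨ConjQuery.isVP_Q F, fun τ f => ⟨⟨IsVP.exists_isPProjection_Q, ?_⟩, ?_, ?_⟩⟩
  · rintro ⟨Φ, hsize, hΦ, hf⟩
    exact (ConjQuery.isVP_Q F Φ (hstar Φ hΦ).1 hsize (hstar Φ hΦ).2).of_isPProjection hf
  · intro hf
    obtain ⟨Φ, hsize, hΦ, hf⟩ := hf.exists_isPProjection_Q
    exact ⟨Φ, hsize, (hstar Φ hΦ).1, (hstar Φ hΦ).2, hf⟩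
  · rintro ⟨Φ, hsize, hΦ, hk, hf⟩
    exact (ConjQuery.isVP_Q F Φ hΦ hsize hk).of_isPProjection hf
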